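/- All graphs are finite and simple. For a graph $G$ and $k\ge 0$, the ball of radius $k$ around a vertex $v$ is $N^k[v]=\{u : dist_G(u,v)\le k\}$. A $k$-AT of $G$ is a triple $x,y,z$ of vertices such that, for any two of them, there is a path between these two that avoids the ball of radius $k$ around the third one; $G$ is $k$-AT-free if it contains no $k$-AT. A graph is chordal if every cycle of length at least $4$ has a chord, and split if its vertex set can be partitioned into a clique and a stable set. The Strong Exponential-Time Hypothesis (SETH) says that for every $\varepsilon>0$ there is a $k$ such that $k$-SAT on $n$ variables (formulas being given as lists without repetitions of clauses with at most $k$ literals each) cannot be solved in $\mathcal{O}((2-\varepsilon)^n)$ time. A truly subquadratic algorithm for computing the diameter on a class $\mathcal C$ of graphs is an algorithm that, given the list of edges of any connected graph $G\in\mathcal C$, outputs the diameter of $G$ in time $\mathcal{O}(m^b)$, where $m$ is the number of edges of $G$ (the one-vertex graph being allowed constant time), for some fixed positive $b<2$. Algorithms are deterministic programs for a random-access machine with the operations $+$, $-$, $\times$ and integer division, and running time is measured by the logarithmic cost criterion (every elementary step costs one plus the binary lengths of the numbers and of the memory address that it handles). **Proposition.** Let $k\ge 2$. Then every split graph is $k$-AT-free.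 Moreover, under SETH, there is no truly subquadratic algorithm for computing the diameter of $k$-AT-free chordal graphs. -/

import Mathlib

namespace SimpleGraph

/-- A graph is chordal if every cycle of length at least four has a chord: an edge joining two
vertices of the cycle that is not an edge of the cycle. -/
def IsChordal {V : Type*} (G : SimpleGraph V) : Prop :=
  ∀ (v : V) (c : G.Walk v v), c.IsCycle → 4 ≤ c.length →
    ∃ x ∈ c.support, ∃ y ∈ c.support, G.Adj x y ∧ s(x, y) ∉ c.edges

/-- A split graph: the vertex set can be partitioned into a clique `K` and a stable set. -/
def IsSplit {V : Type*} (G : SimpleGraph V) : Prop :=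
  ∃ K : Set V, G.IsClique K ∧ G.IsIndepSet Kᶜ

/-- The ball `N^k[v]` of radius `k` around `v`. -/
def ballAt {V : Type*} (G : SimpleGraph V) (k : ℕ) (v : V) : Set V :=
  {u | G.edist u v ≤ k}

/-- There is an `x`-`y` path in `G` that avoids the vertex set `A`. -/
def PathAvoiding {V : Type*} (G : SimpleGraph V) (x y : V) (A : Set V) : Prop :=
  ∃ p : G.Walk x y, p.IsPath ∧ ∀ w ∈ p.support, w ∉ A

/-- `x, y, z` form a `k`-AT: any two of them are joined by a path that avoids the ball of radius
`k` around the third one. -/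
def IsKAT {V : Type*} (G : SimpleGraph V) (k : ℕ) (x y z : V) : Prop :=
  G.PathAvoiding x y (G.ballAt k z) ∧ G.PathAvoiding y z (G.ballAt k x) ∧
    G.PathAvoiding x z (G.ballAt k y)

/-- A graph is `k`-AT-free if it contains no `k`-AT. -/
def IsKATFree {V : Type*} (G : SimpleGraph V) (k : ℕ) : Prop :=
  ∀ x y z : V, ¬ G.IsKAT k x y z

end SimpleGraph

/-! ### Random-access machines with logarithmic cost -/

namespace RAM

/-- Arithmetic operations on natural numbers; subtraction is truncated, division is rounded down,
and division by `0` returns `0`. -/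
inductive ArithOp
  | add
  | sub
  | mul
  | div

/-- The result of an arithmetic operation. -/
def ArithOp.eval : ArithOp → ℕ → ℕ → ℕ
  | .add, x, y => x + y
  | .sub, x, y => x - y
  | .mul, x, y => x * y
  | .div, x, y => x / y

/-- A machine state: registers, and the random-access memory. A program names only finitely many
registers; the memory is accessed by computed addresses. -/
structure State where
  reg : ℕ → ℕ
  mem : ℕ → ℕ

/-- Write `x` to register `r`. -/
def State.setReg (s : State) (r x : ℕ) : State :=
  { s with reg := Function.update s.reg r x }

/-- Write `x` to memory cell `a`. -/
def State.setMem (s : State) (a x : ℕ) : State :=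
  { s with mem := Function.update s.mem a x }

/-- RAM programs, with structured control flow. -/
inductive Prog
  /-- do nothing -/
  | skip
  /-- `reg r := c` -/
  | const (r c : ℕ)
  /-- `reg r := reg a ∘ reg b` -/
  | arith (o : ArithOp) (r a b : ℕ)
  /-- `reg r := mem (reg a)` -/
  | load (r a : ℕ)
  /-- `mem (reg a) := reg b` -/
  | store (a b : ℕ)
  /-- first `p`, then `q` -/
  | seq (p q : Prog)
  /-- if `reg r ≠ 0` then `p` else `q` -/
  | cond (r : ℕ) (p q : Prog)
  /-- while `reg r ≠ 0` do `p` -/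
  | loop (r : ℕ) (p : Prog)

/-- `Exec p s s' t`: started in state `s`, the program `p` halts in state `s'`, at total
logarithmic cost `t`. Every elementary step, including every test of a conditional or a loop, costs
one plus the binary lengths (`Nat.size`) of the numbers and of the memory address it handles. -/
inductive Exec : Prog → State → State → ℕ → Prop
  | skip (s : State) : Exec .skip s s 1
  | const (r c : ℕ) (s : State) : Exec (.const r c) s (s.setReg r c) (1 + c.size)
  | arith (o : ArithOp) (r a b : ℕ) (s : State) :
      Exec (.arith o r a b) s (s.setReg r (o.eval (s.reg a) (s.reg b)))
        (1 + (s.reg a).size + (s.reg b).size)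
  | load (r a : ℕ) (s : State) :
      Exec (.load r a) s (s.setReg r (s.mem (s.reg a)))
        (1 + (s.reg a).size + (s.mem (s.reg a)).size)
  | store (a b : ℕ) (s : State) :
      Exec (.store a b) s (s.setMem (s.reg a) (s.reg b))
        (1 + (s.reg a).size + (s.reg b).size)
  | seq {p q : Prog} {s s' s'' : State} {t t' : ℕ} :
      Exec p s s' t → Exec q s' s'' t' → Exec (.seq p q) s s'' (t + t')
  | cond_pos {r : ℕ} {p q : Prog} {s s' : State} {t : ℕ} :
      s.reg r ≠ 0 → Exec p s s' t → Exec (.cond r p q) s s' (1 + (s.reg r).size + t)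
  | cond_zero {r : ℕ} {p q : Prog} {s s' : State} {t : ℕ} :
      s.reg r = 0 → Exec q s s' t → Exec (.cond r p q) s s' (1 + (s.reg r).size + t)
  | loop_zero {r : ℕ} {p : Prog} {s : State} :
      s.reg r = 0 → Exec (.loop r p) s s (1 + (s.reg r).size)
  | loop_pos {r : ℕ} {p : Prog} {s s' s'' : State} {t t' : ℕ} :
      s.reg r ≠ 0 → Exec p s s' t → Exec (.loop r p) s' s'' t' →
        Exec (.loop r p) s s'' (1 + (s.reg r).size + t + t')

/-- The initial state on input `w`: the words of `w` are in the memory cells `0, 1, 2, …`, and all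
other cells and all registers are `0`. -/
def initial (w : List ℕ) : State where
  reg := fun _ => 0
  mem := fun i => w.getD i 0

/-- On input `w` the program `p` halts in time at most `T` with output `out` in register `0`. -/
def Outputs (p : Prog) (w : List ℕ) (out : ℕ) (T : ℝ) : Prop :=
  ∃ (s : State) (t : ℕ), Exec p (initial w) s t ∧ s.reg 0 = out ∧ (t : ℝ) ≤ T

end RAM

/-! ### The Strong Exponential-Time Hypothesis -/

/-- `f` is a `k`-CNF formula: every clause has at most `k` literals. Formulas are sets of clauses
and clauses are sets of literals, listed without repetitions (so that the size of a `k`-CNF formula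
is polynomial in its number of variables, for fixed `k`). -/
def IsKCNF {n : ℕ} (k : ℕ) (f : Std.Sat.CNF (Fin n)) : Prop :=
  f.clauses.toList.Nodup ∧ ∀ c ∈ f.clauses.toList, c.Nodup ∧ c.length ≤ k

/-- The input words for a formula: the number of variables, the number of clauses, and then each
clause, as the number of its literals followed by the literals; the positive and the negative
literal of variable `i` are written `2 * i + 1` and `2 * i`. -/
def encodeCNF {n : ℕ} (f : Std.Sat.CNF (Fin n)) : List ℕ :=
  n :: f.clauses.toList.length ::
    f.clauses.toList.flatMap fun c => c.length :: c.map fun l => 2 * (l.1 : ℕ) + l.2.toNat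

open Classical in
/-- The program `p` decides `k`-SAT, in time at most `T n` on formulas with `n` variables. -/
def SolvesKSAT (k : ℕ) (p : RAM.Prog) (T : ℕ → ℝ) : Prop :=
  ∀ (n : ℕ) (f : Std.Sat.CNF (Fin n)), IsKCNF k f →
    RAM.Outputs p (encodeCNF f) (if ∃ a, Std.Sat.CNF.Sat a f then 1 else 0) (T n)

/-- The Strong Exponential-Time Hypothesis: for every `ε > 0` there is a `k` such that `k`-SAT on
`n` variables cannot be solved in time `O((2 - ε) ^ n)`. -/
def SETH : Prop :=
  ∀ ε : ℝ, 0 < ε → ∃ k : ℕ, ¬ ∃ (p : RAM.Prog) (C : ℝ),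
    SolvesKSAT k p fun n => C * (2 - ε) ^ n

/-! ### Computing the diameter -/

/-- `l` lists every edge of `G` exactly once, in any order and with its ends in any order. -/
def ListsEdges {n : ℕ} (G : SimpleGraph (Fin n)) (l : List (Fin n × Fin n)) : Prop :=
  (l.map fun e => s(e.1, e.2)).Nodup ∧
    ∀ e : Sym2 (Fin n), e ∈ G.edgeSet ↔ e ∈ l.map fun e => s(e.1, e.2)

/-- The input words for a graph: the number of vertices, the number of edges, and then the two ends
of each edge. -/
def encodeGraph (n : ℕ) (l : List (Fin n × Fin n)) : List ℕ :=
  n :: l.length :: l.flatMap fun e => [(e.1 : ℕ), (e.2 : ℕ)]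

/-- There is a truly subquadratic algorithm for computing the diameter of the graphs in the class
`𝒞`: for some positive `b < 2` it runs in time `O(m ^ b)` on the connected graphs in `𝒞`, `m` being
the number of edges (`m + 1` below lets the one-vertex graph take constant time). -/
def HasTrulySubquadraticDiameterAlgorithm
    (𝒞 : ∀ n : ℕ, SimpleGraph (Fin n) → Prop) : Prop :=
  ∃ (p : RAM.Prog) (b C : ℝ), 0 < b ∧ b < 2 ∧
    ∀ (n : ℕ) (G : SimpleGraph (Fin n)), G.Connected → 𝒞 n G →
      ∀ l : List (Fin n × Fin n), ListsEdges G l →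
        RAM.Outputs p (encodeGraph n l) G.diam (C * ((G.edgeSet.ncard : ℝ) + 1) ^ b)

/-! In a split graph every edge has an end in the clique `K`, so a vertex `z` that is not isolated
lies within distance 2 of all of `K`. For `k ≥ 2` the ball around `z` contains `K`, hence an end of
every edge, and no path with an edge avoids it (`IsSplit.isKATFree`). The same observation puts two
clique vertices two steps apart on every long cycle, which gives a chord (`IsSplit.isChordal`).
Hence hardness only has to be shown on split graphs.

For this, satisfiability is reduced to the diameter. The `n` variables are split into two halves.
The graph has a clique with one vertex per clause, and one vertex per assignment of either half,
joined to the clauses that this half alone does not satisfy. A low and a high assignment have a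
common neighbour exactly if their union leaves some clause unsatisfied. Two unit clauses in a fresh
variable, number `n`, are added; low assignments make it false and high ones true. One of these
clauses is joined to all low vertices and to no high one, the other to all high vertices and to no
low one. So the graph is connected, vertices of the same half are close, and the diameter is 3 if
the formula is satisfiable and at most 2 otherwise (`reductionGraph_connected_and_diam`).

For bounded clause length the number of clauses is polynomial in `n`, so the graph has `2 ^ (n / 2)`
edges up to a polynomial factor, and time `m ^ b` with `b < 2` becomes `O(ρ ^ n)` for some `ρ < 2`
(`exists_time_bound`). The remaining work is a machine program for the reduction, with a proof of
its cost. It must end exactly in the initial state on the graph (`exec_reductionProg`), so that the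
assumed diameter program can be run after it (`outputs_satProg`). -/

namespace SimpleGraph

/-! ### Split graphs: absence of `k`-ATs, and chordality. -/

variable {V : Type*} {G : SimpleGraph V}

theorem IsSplit.isKATFree (hG : G.IsSplit) {k : ℕ} (hk : 2 ≤ k) : G.IsKATFree k := by
  obtain ⟨K, hK, hS⟩ := hG
  have hmeet : ∀ {u v}, G.Adj u v → u ∈ K ∨ v ∈ K := by
    intro u v huv
    by_contra! h
    exact hS h.1 h.2 huv.ne huv
  have hself : ∀ v, v ∈ G.ballAt k v := fun v => by simp [ballAt]
  have hball : ∀ {z z' w}, G.Adj z z' → w ∈ K → w ∈ G.ballAt k z := by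
    intro z z' w hz hw
    have h2 : ∃ p : G.Walk w z, p.length ≤ 2 := by
      obtain ⟨a, ha, q, hq⟩ : ∃ a ∈ K, ∃ q : G.Walk a z, q.length ≤ 1 := by
        rcases hmeet hz with h | h
        · exact ⟨z, h, .nil, by simp⟩
        · exact ⟨z', h, .cons hz.symm .nil, by simp⟩
      by_cases hwa : w = a
      · subst hwa
        exact ⟨q, by lia⟩
      · exact ⟨.cons (hK hw ha hwa) q, by simpa using hq⟩
    obtain ⟨p, hp⟩ := h2
    refine (p.edist_le).trans ?_
    exact_mod_cast hp.trans hk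
  have hnbr : ∀ {u v}, u ≠ v → G.Walk u v → ∃ w, G.Adj u w := by
    intro u v huv p
    cases p with
    | nil => exact absurd rfl huv
    | cons h _ => exact ⟨_, h⟩
  rintro x y z ⟨⟨p, -, hp⟩, ⟨q, -, hq⟩, ⟨r, -, hr⟩⟩
  have hxy : x ≠ y := by
    rintro rfl
    exact hq x q.start_mem_support (hself x)
  have hyz : z ≠ y := by
    rintro rfl
    exact hr _ r.end_mem_support (hself _)
  -- `z` is joined by a path to `y ≠ z`, so it is not isolated; `hball` needs this, because the ball
  -- around an isolated vertex may miss `K`.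
  obtain ⟨z', hz⟩ := hnbr hyz q.reverse
  cases p with
  | nil => exact hxy rfl
  | cons h p =>
    rcases hmeet h with h' | h'
    · exact hp _ (by simp) (hball hz h')
    · exact hp _ (by simp) (hball hz h')

theorem Walk.IsCycle.getVert_eq_iff {v : V} {c : G.Walk v v} (hc : c.IsCycle) {i j : ℕ}
    (hi : i ≤ c.length) (hj : j ≤ c.length) (h : c.getVert i = c.getVert j) :
    i = j ∨ (i = 0 ∧ j = c.length) ∨ (i = c.length ∧ j = 0) := by
  by_cases h0 : 1 ≤ i ∧ 1 ≤ j
  · exact .inl (hc.getVert_injOn ⟨h0.1, hi⟩ ⟨h0.2, hj⟩ h)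
  · by_cases h1 : i ≤ c.length - 1 ∧ j ≤ c.length - 1
    · exact .inl (hc.getVert_injOn' h1.1 h1.2 h)
    · lia

/-- Edges of the cycle join consecutive positions. Positions determine vertices up to identifying
the two ends, and length at least 4 rules out that two steps forward equal one step back around the
cycle. -/
theorem Walk.IsCycle.not_mem_edges_getVert_add_two {v : V} {c : G.Walk v v} (hc : c.IsCycle)
    (h4 : 4 ≤ c.length) {i : ℕ} (hi : i + 2 ≤ c.length) :
    s(c.getVert i, c.getVert (i + 2)) ∉ c.edges := by
  intro h
  rw [Walk.mk_mem_edges_iff_exists] at h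
  obtain ⟨j, hj, h⟩ := h
  rcases Sym2.eq_iff.1 h with ⟨h1, h2⟩ | ⟨h1, h2⟩
  · have := hc.getVert_eq_iff (by lia) (by lia) h1
    have := hc.getVert_eq_iff (by lia) (by lia) h2
    lia
  · have := hc.getVert_eq_iff (by lia) (by lia) h1
    have := hc.getVert_eq_iff (by lia) (by lia) h2
    lia

theorem IsSplit.isChordal (hG : G.IsSplit) : G.IsChordal := by
  obtain ⟨K, hK, hS⟩ := hG
  intro v c hc h4
  have hmeet : ∀ i < c.length, c.getVert i ∈ K ∨ c.getVert (i + 1) ∈ K := by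
    intro i hi
    by_contra! h
    have := c.adj_getVert_succ hi
    exact hS h.1 h.2 this.ne this
  -- No two consecutive positions lie outside `K`. If position 1 is outside, then 0 and 2 are
  -- inside; if 3 is outside, then 2 and 4 are inside; otherwise 1 and 3 serve.
  obtain ⟨i, hi, h1, h2⟩ : ∃ i, i + 2 ≤ c.length ∧ c.getVert i ∈ K ∧ c.getVert (i + 2) ∈ K := by
    have h0 := hmeet 0 (by lia)
    have h1 := hmeet 1 (by lia)
    have h2 := hmeet 2 (by lia)
    have h3 := hmeet 3 (by lia)
    by_cases a1 : c.getVert 1 ∈ K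
    · by_cases a3 : c.getVert 3 ∈ K
      · exact ⟨1, by lia, a1, a3⟩
      · exact ⟨2, by lia, by tauto, by tauto⟩
    · exact ⟨0, by lia, by tauto, by tauto⟩
  have hne : c.getVert i ≠ c.getVert (i + 2) := fun h => by
    have := hc.getVert_eq_iff (by lia) (by lia) h
    lia
  exact ⟨_, c.getVert_mem_support i, _, c.getVert_mem_support (i + 2), hK h1 h2 hne,
    hc.not_mem_edges_getVert_add_two h4 hi⟩

/-- A graph with a clique `K` in which the remaining vertices are all joined to `a ∈ K` or all to
`b ∈ K`, according to their type, has diameter at most `3`; it is `3` exactly if some two vertices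
outside `K` have no common neighbour and are distinct and nonadjacent. -/
theorem connected_and_diam_sub_two [Finite V] {K A B : Set V} {a b : V} (hK : G.IsClique K)
    (ha : a ∈ K) (hb : b ∈ K) (hA : ∀ v ∈ A, G.Adj v a) (hB : ∀ v ∈ B, G.Adj v b)
    (hcover : ∀ v, v ∈ K ∨ v ∈ A ∨ v ∈ B) (s : Prop) [Decidable s]
    (hs : s ↔ ∃ x ∈ A, ∃ y ∈ B, x ≠ y ∧ ¬ G.Adj x y ∧ ∀ w, ¬ (G.Adj x w ∧ G.Adj w y)) :
    G.Connected ∧ G.diam - 2 = if s then 1 else 0 := by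
  have hstep : ∀ {u v}, u ∈ K → v ∈ K → ∃ p : G.Walk u v, p.length ≤ 1 := by
    intro u v hu hv
    by_cases h : u = v
    · subst h
      exact ⟨.nil, by simp⟩
    · exact ⟨.cons (hK hu hv h) .nil, by simp⟩
  have htoK : ∀ u, ∃ w ∈ K, ∃ p : G.Walk u w, p.length ≤ 1 := by
    intro u
    rcases hcover u with h | h | h
    · exact ⟨u, h, .nil, by simp⟩
    · exact ⟨a, ha, .cons (hA u h) .nil, by simp⟩
    · exact ⟨b, hb, .cons (hB u h) .nil, by simp⟩
  have hwalk3 : ∀ u v, ∃ p : G.Walk u v, p.length ≤ 3 := by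
    intro u v
    obtain ⟨w, hw, p, hp⟩ := htoK u
    obtain ⟨w', hw', q, hq⟩ := htoK v
    obtain ⟨r, hr⟩ := hstep hw hw'
    exact ⟨p.append (r.append q.reverse), by simp; lia⟩
  have hne : Nonempty V := ⟨a⟩
  have hconn : G.Connected := ⟨fun u v => (hwalk3 u v).choose.reachable⟩
  have hle3 : ∀ u v, G.dist u v ≤ 3 := fun u v => by
    obtain ⟨p, hp⟩ := hwalk3 u v
    exact (dist_le p).trans hp
  have hle2K : ∀ {u v}, u ∈ K → G.dist u v ≤ 2 := by
    intro u v hu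
    obtain ⟨w', hw', q, hq⟩ := htoK v
    obtain ⟨r, hr⟩ := hstep hu hw'
    exact (dist_le (r.append q.reverse)).trans (by simp; lia)
  have hle2c : ∀ {u v w}, G.Adj u w → G.Adj v w → G.dist u v ≤ 2 := by
    intro u v w h1 h2
    exact (dist_le (.cons h1 (.cons h2.symm .nil))).trans (by simp)
  have htop := connected_iff_ediam_ne_top.1 hconn
  refine ⟨hconn, ?_⟩
  -- All distances are at most 3, and truncated subtraction sends every diameter up to 2 to 0. It
  -- remains to decide whether the distance 3 is attained; this can only happen between `A` and `B`,
  -- as `a` and `b` serve the pairs within one type.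
  obtain ⟨u, v, huv⟩ := G.exists_dist_eq_diam
  split_ifs with h
  · obtain ⟨x, hx, y, hy, hxy, hadj, hcom⟩ := hs.1 h
    have h3 : 3 ≤ G.dist x y := by
      by_contra! hlt
      obtain ⟨p, hp⟩ := hconn.exists_walk_length_eq_dist x y
      rw [← hp] at hlt
      rcases p with _ | ⟨h1, _ | ⟨h2, _ | ⟨h3, p⟩⟩⟩
      · exact hxy rfl
      · exact hadj h1
      · exact hcom _ ⟨h1, h2⟩
      · simp at hlt; lia
    have := h3.trans (dist_le_diam htop)
    have := hle3 u v
    lia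
  · have hAB : ∀ x ∈ A, ∀ y ∈ B, G.dist x y ≤ 2 := by
      intro x hx y hy
      by_contra! hlt
      refine h (hs.2 ⟨x, hx, y, hy, ?_, ?_, ?_⟩)
      · rintro rfl
        simp at hlt
      · intro hadj
        rw [dist_eq_one_iff_adj.2 hadj] at hlt
        lia
      · rintro w ⟨h1, h2⟩
        exact absurd (hle2c h1 h2.symm) (by lia)
    have : G.dist u v ≤ 2 := by
      rcases hcover u with hu | hu | hu
      · exact hle2K hu
      · rcases hcover v with hv | hv | hv
        · rw [dist_comm]
          exact hle2K hv
        · exact hle2c (hA u hu) (hA v hv)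
        · exact hAB u hu v hv
      · rcases hcover v with hv | hv | hv
        · rw [dist_comm]
          exact hle2K hv
        · rw [dist_comm]
          exact hAB v hv u hu
        · exact hle2c (hB u hu) (hB v hv)
    lia

end SimpleGraph

theorem ListsEdges.ncard_edgeSet_le {n : ℕ} {G : SimpleGraph (Fin n)}
    {l : List (Fin n × Fin n)} (h : ListsEdges G l) : G.edgeSet.ncard ≤ l.length := by
  classical
  have : G.edgeSet = ((l.map fun e => s(e.1, e.2)).toFinset : Set (Sym2 (Fin n))) := by
    ext e
    simpa using h.2 e
  rw [this, Set.ncard_coe_finset]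
  exact (List.toFinset_card_le _).trans (by simp)

/-! ### Step counting and loop rules for machine programs. -/

namespace RAM

/-- The registers that a program may write to. -/
def Prog.writes : Prog → List ℕ
  | .skip => []
  | .const r _ => [r]
  | .arith _ r _ _ => [r]
  | .load r _ => [r]
  | .store _ _ => []
  | .seq p q => p.writes ++ q.writes
  | .cond _ p q => p.writes ++ q.writes
  | .loop _ p => p.writes

theorem Exec.reg_eq_of_notMem_writes {p : Prog} {s s' : State} {t : ℕ} (h : Exec p s s' t) {r : ℕ}
    (hr : r ∉ p.writes) : s'.reg r = s.reg r := by
  induction h <;> simp_all [Prog.writes, State.setReg, State.setMem]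

/-- All registers and memory cells hold numbers less than `B`. -/
def State.Bdd (B : ℕ) (s : State) : Prop :=
  (∀ r, s.reg r < B) ∧ ∀ a, s.mem a < B

theorem State.Bdd.setReg {B : ℕ} {s : State} (h : s.Bdd B) {r x : ℕ} (hx : x < B) :
    (s.setReg r x).Bdd B := by
  refine ⟨fun r' => ?_, h.2⟩
  by_cases hr : r' = r
  · simpa [State.setReg, hr] using hx
  · simpa [State.setReg, hr] using h.1 r'

theorem State.Bdd.setMem {B : ℕ} {s : State} (h : s.Bdd B) {a x : ℕ} (hx : x < B) :
    (s.setMem a x).Bdd B := by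
  refine ⟨h.1, fun a' => ?_⟩
  by_cases ha : a' = a
  · simpa [State.setMem, ha] using hx
  · simpa [State.setMem, ha] using h.2 a'

/-- Started in `s`, the program `p` halts after at most `T` elementary steps in a state satisfying
`Q`, and all numbers stay below `B`; registers that `p` does not mention keep their values. -/
def WP (B : ℕ) (p : Prog) (T : ℕ) (Q : State → Prop) (s : State) : Prop :=
  ∃ (s' : State) (t : ℕ), Exec p s s' t ∧ t ≤ T * (2 * B.size + 1) ∧ s'.Bdd B ∧
    (∀ r ∉ p.writes, s'.reg r = s.reg r) ∧ Q s'

theorem WP.mono {B : ℕ} {p : Prog} {T T' : ℕ} {Q Q' : State → Prop} {s : State}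
    (h : WP B p T Q s) (hT : T ≤ T')
    (hQ : ∀ s', s'.Bdd B → (∀ r ∉ p.writes, s'.reg r = s.reg r) → Q s' → Q' s') :
    WP B p T' Q' s := by
  obtain ⟨s', t, he, ht, hb, hf, hq⟩ := h
  exact ⟨s', t, he, ht.trans (Nat.mul_le_mul_right _ hT), hb, hf, hQ s' hb hf hq⟩

theorem WP.seq {B : ℕ} {p q : Prog} {T T' : ℕ} {R Q : State → Prop} {s : State}
    (hp : WP B p T R s)
    (hq : ∀ s', s'.Bdd B → (∀ r ∉ p.writes, s'.reg r = s.reg r) → R s' → WP B q T' Q s') :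
    WP B (.seq p q) (T + T') Q s := by
  obtain ⟨s', t, he, ht, hb, hf, hr⟩ := hp
  obtain ⟨s'', t', he', ht', hb', -, hq'⟩ := hq s' hb hf hr
  have he'' := Exec.seq he he'
  exact ⟨s'', _, he'', by rw [add_mul]; exact add_le_add ht ht', hb',
    fun r hr => he''.reg_eq_of_notMem_writes hr, hq'⟩

/-- The effect of a loop-free program. -/
def Prog.eval : Prog → State → State
  | .skip, s => s
  | .const r c, s => s.setReg r c
  | .arith o r a b, s => s.setReg r (o.eval (s.reg a) (s.reg b))
  | .load r a, s => s.setReg r (s.mem (s.reg a))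
  | .store a b, s => s.setMem (s.reg a) (s.reg b)
  | .seq p q, s => q.eval (p.eval s)
  | .cond r p q, s => if s.reg r = 0 then q.eval s else p.eval s
  | .loop _ _, s => s

/-- The maximal number of steps of a loop-free program. -/
def Prog.steps : Prog → ℕ
  | .seq p q => p.steps + q.steps
  | .cond _ p q => 1 + max p.steps q.steps
  | _ => 1

/-- The program `p` is loop-free, and started in `s` it only computes numbers less than `B`. -/
def Prog.Safe (B : ℕ) : Prog → State → Prop
  | .skip, _ => True
  | .const _ c, _ => c < B
  | .arith o _ a b, s => o.eval (s.reg a) (s.reg b) < B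
  | .load _ _, _ => True
  | .store _ _, _ => True
  | .seq p q, s => p.Safe B s ∧ q.Safe B (p.eval s)
  | .cond r p q, s => if s.reg r = 0 then q.Safe B s else p.Safe B s
  | .loop _ _, _ => False

/-- An elementary step handles at most two numbers, all below `B`, so it costs at most `2 * B.size +
1`; logarithmic cost thus reduces to counting steps. -/
theorem exec_eval {B : ℕ} {p : Prog} {s : State} (hs : s.Bdd B) (hp : p.Safe B s) :
    (p.eval s).Bdd B ∧ ∃ t ≤ p.steps * (2 * B.size + 1), Exec p s (p.eval s) t := by
  have hsz : ∀ {x}, x < B → x.size ≤ B.size := fun h => Nat.size_le_size h.le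
  induction p generalizing s with
  | skip => exact ⟨hs, _, by simp [Prog.steps], .skip s⟩
  | const r c =>
    have := hsz hp
    exact ⟨hs.setReg hp, _, by simp [Prog.steps]; lia, .const r c s⟩
  | arith o r a b =>
    have h1 := hsz (hs.1 a)
    have h2 := hsz (hs.1 b)
    exact ⟨hs.setReg hp, _, by simp only [Prog.steps]; lia, .arith o r a b s⟩
  | load r a =>
    have h1 := hsz (hs.1 a)
    have h2 := hsz (hs.2 (s.reg a))
    exact ⟨hs.setReg (hs.2 _), _, by simp only [Prog.steps]; lia, .load r a s⟩
  | store a b =>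
    have h1 := hsz (hs.1 a)
    have h2 := hsz (hs.1 b)
    exact ⟨hs.setMem (hs.1 _), _, by simp only [Prog.steps]; lia, .store a b s⟩
  | seq p q ihp ihq =>
    obtain ⟨hb, t, ht, he⟩ := ihp hs hp.1
    obtain ⟨hb', t', ht', he'⟩ := ihq hb hp.2
    exact ⟨hb', _, by rw [Prog.steps, add_mul]; exact add_le_add ht ht', .seq he he'⟩
  | cond r p q ihp ihq =>
    have h1 := hsz (hs.1 r)
    by_cases h : s.reg r = 0
    · simp only [Prog.Safe, h, if_true] at hp
      obtain ⟨hb, t, ht, he⟩ := ihq hs hp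
      simp only [Prog.eval, h, if_true]
      refine ⟨hb, _, ?_, .cond_zero h he⟩
      have := Nat.mul_le_mul_right (2 * B.size + 1) (le_max_right p.steps q.steps)
      rw [Prog.steps, add_mul]
      lia
    · simp only [Prog.Safe, h, if_false] at hp
      obtain ⟨hb, t, ht, he⟩ := ihp hs hp
      simp only [Prog.eval, h, if_false]
      refine ⟨hb, _, ?_, .cond_pos h he⟩
      have := Nat.mul_le_mul_right (2 * B.size + 1) (le_max_left p.steps q.steps)
      rw [Prog.steps, add_mul]
      lia
  | loop r p => exact hp.elim

theorem WP.straight {B : ℕ} {p : Prog} {T : ℕ} {Q : State → Prop} {s : State} (hs : s.Bdd B)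
    (hT : p.steps ≤ T) (hp : p.Safe B s) (hQ : Q (p.eval s)) : WP B p T Q s := by
  obtain ⟨hb, t, ht, he⟩ := exec_eval hs hp
  exact ⟨_, t, he, ht.trans (Nat.mul_le_mul_right _ hT), hb,
    fun r hr => he.reg_eq_of_notMem_writes hr, hQ⟩

/-- Run `p` as many times as register `c` says; register `1` has to hold `1`. -/
def forLoop (c : ℕ) (p : Prog) : Prog :=
  .loop c (.seq p (.arith .sub c c 1))

/-- Every round adds a test and a decrement to the `T` steps of the body, and one last test ends the
loop. Since the counter is decremented after the body, the invariant must not depend on register `c`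
(`hI`). -/
theorem WP.forLoop {B c : ℕ} {p : Prog} {n T : ℕ} {I : ℕ → State → Prop} {s : State}
    (hs : s.Bdd B) (hc : c ∉ p.writes) (h1 : 1 ∉ p.writes) (hc1 : c ≠ 1) (hs1 : s.reg 1 = 1)
    (hn : s.reg c = n) (h0 : I 0 s)
    (hI : ∀ i s' x, I i s' → I i (s'.setReg c x))
    (step : ∀ i s', i < n → s'.Bdd B → (∀ r ∉ c :: p.writes, s'.reg r = s.reg r) →
      I i s' → WP B p T (I (i + 1)) s') :
    WP B (forLoop c p) (n * (T + 2) + 1) (I n) s := by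
  -- Induction on the rounds `j` still to come, which the counter holds, while the invariant is
  -- indexed by the rounds `i` already done.
  suffices h : ∀ j i s', i + j = n → s'.Bdd B → (∀ r ∉ c :: p.writes, s'.reg r = s.reg r) →
      s'.reg c = j → I i s' → WP B (RAM.forLoop c p) (j * (T + 2) + 1) (I n) s' from
    h n 0 s (by lia) hs (fun _ _ => rfl) hn h0
  intro j
  induction j with
  | zero =>
    intro i s' hi hb hf hr hi'
    obtain rfl : i = n := by lia
    exact ⟨s', _, .loop_zero hr, by simp [hr], hb, fun _ _ => rfl, hi'⟩
  | succ j ih =>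
    intro i s' hi hb hf hr hi'
    obtain ⟨s₁, t₁, he₁, ht₁, hb₁, hf₁, hi₁⟩ := step i s' (by lia) hb hf hi'
    have hreg1 : s₁.reg 1 = 1 := by
      rw [hf₁ 1 h1, hf 1 (by simp [h1, Ne.symm hc1]), hs1]
    have hregc : s₁.reg c = j + 1 := by rw [hf₁ c hc, hr]
    have hsz : (j + 1).size ≤ B.size := hr ▸ Nat.size_le_size (hb.1 c).le
    have hB : 1 < B := hreg1 ▸ hb₁.1 1
    obtain ⟨hb₂, t₂, ht₂, he₂⟩ := exec_eval (p := .arith .sub c c 1) hb₁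
      (by simp only [Prog.Safe, ArithOp.eval, hregc, hreg1]; have := hb₁.1 c; lia)
    simp only [Prog.eval, ArithOp.eval, hregc, hreg1, Nat.add_sub_cancel] at hb₂ he₂
    obtain ⟨s₃, t₃, he₃, ht₃, hb₃, -, hi₃⟩ := ih (i + 1) _ (by lia) hb₂ (by
      intro r hr'
      simp only [List.mem_cons, not_or] at hr'
      simp [State.setReg, hr'.1, hf₁ r hr'.2, hf r (by simp [hr'])])
      (by simp [State.setReg]) (hI _ _ _ hi₁)
    have he := Exec.loop_pos (by rw [hr]; simp) (.seq he₁ he₂) he₃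
    refine ⟨s₃, _, he, ?_, hb₃, fun r hr => he.reg_eq_of_notMem_writes hr, hi₃⟩
    rw [hr]
    simp only [Prog.steps] at ht₂
    calc _ ≤ (1 + 2 * B.size) + (T * (2 * B.size + 1) + 1 * (2 * B.size + 1))
          + (j * (T + 2) + 1) * (2 * B.size + 1) := by lia
      _ = _ := by ring

/-- Sequential composition of a list of programs. -/
def block : List Prog → Prog
  | [] => .skip
  | p :: ps => .seq p (block ps)

@[simp] theorem setReg_reg (s : State) (r x r' : ℕ) :
    (s.setReg r x).reg r' = if r' = r then x else s.reg r' := by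
  simp [State.setReg, Function.update_apply]

@[simp] theorem setReg_mem (s : State) (r x : ℕ) : (s.setReg r x).mem = s.mem := rfl

@[simp] theorem setMem_reg (s : State) (a x : ℕ) : (s.setMem a x).reg = s.reg := rfl

@[simp] theorem setMem_mem (s : State) (a x : ℕ) :
    (s.setMem a x).mem = Function.update s.mem a x := rfl

attribute [simp] block Prog.eval Prog.Safe ArithOp.eval

end RAM

/-! ### Clauses, masks and rows of pairs as lists of numbers. -/

/-- Whether the literal with code `l` is satisfied by the partial assignment that makes the
variables in the bit set `P` true and those in `Q` false. -/
def LitTrue (P Q l : ℕ) : Prop :=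
  (if l % 2 = 0 then Q else P) / 2 ^ (l / 2) % 2 = 1

instance (P Q l : ℕ) : Decidable (LitTrue P Q l) := by
  unfold LitTrue
  infer_instance

/-- No literal of the clause `c` is satisfied by the partial assignment `(P, Q)`. -/
def Falsified (P Q : ℕ) (c : List ℕ) : Prop :=
  ∀ l ∈ c, ¬ LitTrue P Q l

instance (P Q : ℕ) (c : List ℕ) : Decidable (Falsified P Q c) := by
  unfold Falsified
  infer_instance

/-- The words of a list of clauses: each clause is preceded by its length. -/
def clauseWords (cs : List (List ℕ)) : List ℕ :=
  cs.flatMap fun c => c.length :: c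

/-- The words of a list of pairs. -/
def pairWords (L : List (ℕ × ℕ)) : List ℕ :=
  L.flatMap fun e => [e.1, e.2]

/-- The pairs `(u, v)` with `v < V` such that `(P, Q)` falsifies the clause number `v`. -/
def rowPairs (cs : List (List ℕ)) (u V P Q : ℕ) : List (ℕ × ℕ) :=
  ((List.range V).filter fun v => Falsified P Q (cs.getD v [])).map fun v => (u, v)

/-- The pairs of consecutive rows, with parameters in arithmetic progression. -/
def rowsPairs (cs : List (List ℕ)) (cnt u V dv P Q d : ℕ) : List (ℕ × ℕ) :=
  (List.range cnt).flatMap fun i => rowPairs cs (u + i) (V + i * dv) (P + i * d) (Q - i * d)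

theorem clauseWords_append (cs cs' : List (List ℕ)) :
    clauseWords (cs ++ cs') = clauseWords cs ++ clauseWords cs' := by
  simp [clauseWords]

theorem clauseWords_split {cs : List (List ℕ)} {v : ℕ} (hv : v < cs.length) :
    clauseWords cs =
      clauseWords (cs.take v) ++ (cs[v].length :: cs[v] ++ clauseWords (cs.drop (v + 1))) := by
  conv_lhs => rw [← List.take_append_drop v cs, List.drop_eq_getElem_cons hv]
  simp only [clauseWords, List.flatMap_append, List.flatMap_cons, List.cons_append]

theorem length_clauseWords_take_succ {cs : List (List ℕ)} {v : ℕ} (hv : v < cs.length) :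
    (clauseWords (cs.take (v + 1))).length =
      (clauseWords (cs.take v)).length + 1 + cs[v].length := by
  rw [List.take_succ_eq_append_getElem hv, clauseWords_append]
  simp [clauseWords]
  lia

theorem length_pairWords (L : List (ℕ × ℕ)) : (pairWords L).length = 2 * L.length := by
  induction L with
  | nil => rfl
  | cons e L ih => simp [pairWords] at ih ⊢; lia

theorem pairWords_append (L L' : List (ℕ × ℕ)) :
    pairWords (L ++ L') = pairWords L ++ pairWords L' := by
  simp [pairWords]

theorem rowPairs_succ (cs : List (List ℕ)) (u V P Q : ℕ) :
    rowPairs cs u (V + 1) P Q =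
      rowPairs cs u V P Q ++ if Falsified P Q (cs.getD V []) then [(u, V)] else [] := by
  simp only [rowPairs, List.range_succ, List.filter_append, List.map_append]
  by_cases h : Falsified P Q (cs.getD V []) <;> simp only [List.filter, h] <;> simp

theorem rowsPairs_succ (cs : List (List ℕ)) (cnt u V dv P Q d : ℕ) :
    rowsPairs cs (cnt + 1) u V dv P Q d = rowsPairs cs cnt u V dv P Q d ++
      rowPairs cs (u + cnt) (V + cnt * dv) (P + cnt * d) (Q - cnt * d) := by
  simp [rowsPairs, List.range_succ]

theorem length_rowPairs_le (cs : List (List ℕ)) (u V P Q : ℕ) :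
    (rowPairs cs u V P Q).length ≤ V := by
  rw [rowPairs, List.length_map]
  exact (List.length_filter_le _ _).trans (by simp)

theorem length_rowsPairs_le {cs : List (List ℕ)} {cnt u V dv P Q d K : ℕ}
    (h : ∀ i < cnt, V + i * dv ≤ K) : (rowsPairs cs cnt u V dv P Q d).length ≤ cnt * K := by
  induction cnt with
  | zero => simp [rowsPairs]
  | succ cnt ih =>
    rw [rowsPairs_succ, List.length_append, add_mul, one_mul]
    exact add_le_add (ih fun i hi => h i (by lia))
      ((length_rowPairs_le _ _ _ _ _).trans (h cnt (by lia)))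

/-! ### Memory layout and the test of a literal. -/

namespace RAM

/-- The memory that holds the words `out` from address `0` and the words `w` from address `D`. -/
def memOf (out : List ℕ) (D : ℕ) (w : List ℕ) (a : ℕ) : ℕ :=
  if a < D then out.getD a 0 else w.getD (a - D) 0

theorem memOf_add (out : List ℕ) (D : ℕ) (w : List ℕ) (i : ℕ) :
    memOf out D w (D + i) = w.getD i 0 := by
  simp [memOf]

/-- Below `D`, cells past the end of `out` read 0, as do missing list entries; so writing the first
free cell is the same as appending a word. -/
theorem update_memOf {out : List ℕ} {D : ℕ} (w : List ℕ) (h : out.length < D) (x : ℕ) :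
    Function.update (memOf out D w) out.length x = memOf (out ++ [x]) D w := by
  funext a
  simp only [Function.update_apply, memOf]
  split_ifs with h1 h2
  · subst h1
    simp
  · lia
  · rcases lt_or_gt_of_ne h1 with h3 | h3
    · simp [List.getElem?_append_left h3]
    · rw [List.getD_eq_default _ _ (by lia), List.getD_eq_default _ _ (by simp; lia)]
  · rfl

/-- Register `23` is halved as many times as register `19` says. -/
def halveLoop : Prog := forLoop 19 (.arith .div 23 23 2)

theorem wp_halveLoop {B : ℕ} {s : State} (hs : s.Bdd B) (h1 : s.reg 1 = 1) (h2 : s.reg 2 = 2) :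
    WP B halveLoop (s.reg 19 * 3 + 1)
      (fun s' => s'.reg 23 = s.reg 23 / 2 ^ s.reg 19 ∧ s'.mem = s.mem) s := by
  refine WP.forLoop (I := fun i s' => s'.reg 23 = s.reg 23 / 2 ^ i ∧ s'.mem = s.mem) (T := 1)
    hs (by decide) (by decide) (by decide) h1 rfl (by simp) (by simp [setReg_reg, setReg_mem]) ?_
  rintro i s' hi hb hf ⟨hr, hm⟩
  have h2' : s'.reg 2 = 2 := (hf 2 (by decide)).trans h2
  refine WP.straight hb le_rfl ?_ ?_
  · exact (Nat.div_le_self _ _).trans_lt (hb.1 23)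
  · simp [Prog.eval, ArithOp.eval, setReg_reg, setReg_mem, h2', hr, hm, Nat.div_div_eq_div_mul,
      pow_succ]

/-- Read the literal at the address in register `20`, advance that address, and clear the flag in
register `22` if the literal is satisfied by the masks in the registers `12` and `13`. -/
def literalTest : Prog :=
  .seq
    (block [.load 24 20, .arith .add 20 20 1, .arith .div 19 24 2, .arith .add 25 19 19,
      .arith .sub 25 24 25, .cond 25 (.arith .add 23 12 0) (.arith .add 23 13 0)])
    (.seq halveLoop
      (block [.arith .div 25 23 2, .arith .add 25 25 25, .arith .sub 25 23 25,
        .arith .sub 22 22 25]))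

/-- The registers `0`, `1`, `2` hold the constants `0`, `1`, `2`. -/
def State.Consts (s : State) : Prop := s.reg 0 = 0 ∧ s.reg 1 = 1 ∧ s.reg 2 = 2

/-- The machine has neither shifts nor remainders: a parity is obtained as `x - 2 * (x / 2)`, and
the bit of a mask by repeated halving. Truncated subtraction keeps the flag at 0 once it is cleared.
-/
theorem wp_literalTest {B n : ℕ} {s : State} (hs : s.Bdd B) (hc : s.Consts)
    (hn : s.mem (s.reg 20) / 2 ≤ n) (hB : s.reg 20 + 1 < B) :
    WP B literalTest (3 * n + 14)
      (fun s' => s'.reg 20 = s.reg 20 + 1 ∧ s'.mem = s.mem ∧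
        s'.reg 22 = s.reg 22 -
          if LitTrue (s.reg 12) (s.reg 13) (s.mem (s.reg 20)) then 1 else 0) s := by
  obtain ⟨h0, h1, h2⟩ := hc
  have hlB : s.mem (s.reg 20) < B := hs.2 _
  obtain ⟨l, hl⟩ : ∃ l, s.mem (s.reg 20) = l := ⟨_, rfl⟩
  rw [hl] at hn hlB ⊢
  have hPB := hs.1 12
  have hQB := hs.1 13
  refine WP.mono (WP.seq (T := 8) (T' := 3 * n + 6) (R := fun s' => s'.reg 20 = s.reg 20 + 1 ∧
    s'.mem = s.mem ∧ s'.reg 19 = l / 2 ∧ s'.reg 23 = if l % 2 = 0 then s.reg 13 else s.reg 12)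
    ?_ ?_) (by lia) (fun _ _ _ h => h)
  · refine WP.straight hs (by decide) ?_ ?_
    · simp [h0, h1, h2, hl, hPB, hQB]
      lia
    · by_cases h : l - (l / 2 + l / 2) = 0
      · have h' : l % 2 = 0 := by lia
        simp [h0, h1, h2, hl, h, h']
      · have h' : l % 2 = 1 := by lia
        simp [h0, h1, h2, hl, h, h']
  · rintro s₁ hb₁ hf₁ ⟨h20, hm, h19, h23⟩
    have e1 : s₁.reg 1 = 1 := (hf₁ 1 (by decide)).trans h1
    have e2 : s₁.reg 2 = 2 := (hf₁ 2 (by decide)).trans h2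
    have e22 : s₁.reg 22 = s.reg 22 := hf₁ 22 (by decide)
    refine WP.mono (WP.seq (wp_halveLoop hb₁ e1 e2) ?_) (T := (s₁.reg 19 * 3 + 1) + 5)
      (by rw [h19]; lia) (fun _ _ _ h => h)
    rintro s₂ hb₂ hf₂ ⟨g23, gm⟩
    have f2 : s₂.reg 2 = 2 := (hf₂ 2 (by decide)).trans e2
    have f22 : s₂.reg 22 = s.reg 22 := (hf₂ 22 (by decide)).trans e22
    have f20 : s₂.reg 20 = s.reg 20 + 1 := (hf₂ 20 (by decide)).trans h20
    have hyB := hb₂.1 23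
    have f22B := hs.1 22
    have hy : LitTrue (s.reg 12) (s.reg 13) l ↔ s₂.reg 23 % 2 = 1 := by
      rw [g23, h23, h19]; rfl
    refine WP.straight hb₂ (by decide) ?_ ?_
    · simp [f2, f22]
      lia
    · simp [f2, f22, f20, gm, hm, hy]
      split_ifs <;> lia

end RAM

/-! ### Testing clauses and writing the rows of the edge list. -/

namespace RAM

/-- Set the flag in register `22` to `1` if the clause at the address in register `20` is falsified
by the masks in the registers `12` and `13`, and to `0` otherwise; advance the address to the next
clause. -/
def clauseTest : Prog :=
  .seq (block [.load 18 20, .arith .add 20 20 1, .const 22 1]) (forLoop 18 literalTest)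

/-- The loop reads all literals, even after one was found true, so the address always ends at the
next clause. -/
theorem wp_clauseTest {B n k : ℕ} {s : State} (hs : s.Bdd B) (hc : s.Consts) {cl : List ℕ}
    (hk : cl.length ≤ k) (hn : ∀ l ∈ cl, l / 2 ≤ n) (hlen : s.mem (s.reg 20) = cl.length)
    (hmem : ∀ i (h : i < cl.length), s.mem (s.reg 20 + 1 + i) = cl[i])
    (hB : s.reg 20 + 1 + cl.length < B) :
    WP B clauseTest (k * (3 * n + 16) + 5)
      (fun s' => s'.reg 20 = s.reg 20 + 1 + cl.length ∧ s'.mem = s.mem ∧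
        s'.reg 22 = if Falsified (s.reg 12) (s.reg 13) cl then 1 else 0) s := by
  obtain ⟨h0, h1, h2⟩ := hc
  refine WP.mono (WP.seq (T := 4) (T' := cl.length * (3 * n + 14 + 2) + 1)
    (R := fun s' => s'.reg 20 = s.reg 20 + 1 ∧ s'.mem = s.mem ∧ s'.reg 18 = cl.length ∧
      s'.reg 22 = 1) ?_ ?_) (by nlinarith) (fun _ _ _ h => h)
  · refine WP.straight hs (by decide) ?_ ?_
    · simp [h1]
      lia
    · simp [h1, hlen]
  · rintro s₁ hb₁ hf₁ ⟨e20, em, e18, e22⟩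
    have e0 : s₁.reg 0 = 0 := (hf₁ 0 (by decide)).trans h0
    have e1 : s₁.reg 1 = 1 := (hf₁ 1 (by decide)).trans h1
    have e2 : s₁.reg 2 = 2 := (hf₁ 2 (by decide)).trans h2
    have e12 : s₁.reg 12 = s.reg 12 := hf₁ 12 (by decide)
    have e13 : s₁.reg 13 = s.reg 13 := hf₁ 13 (by decide)
    refine WP.mono (WP.forLoop (I := fun i s' => s'.reg 20 = s.reg 20 + 1 + i ∧ s'.mem = s.mem ∧
      s'.reg 22 = if Falsified (s.reg 12) (s.reg 13) (cl.take i) then 1 else 0)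
      hb₁ (by decide) (by decide) (by decide) e1 e18 ?_ ?_ ?_) le_rfl ?_
    · simp [e20, em, e22, Falsified]
    · simp
    · rintro i s₂ hi hb₂ hf₂ ⟨g20, gm, g22⟩
      have g0 : s₂.reg 0 = 0 := (hf₂ 0 (by decide)).trans e0
      have g1 : s₂.reg 1 = 1 := (hf₂ 1 (by decide)).trans e1
      have g2 : s₂.reg 2 = 2 := (hf₂ 2 (by decide)).trans e2
      have g12 : s₂.reg 12 = s.reg 12 := (hf₂ 12 (by decide)).trans e12
      have g13 : s₂.reg 13 = s.reg 13 := (hf₂ 13 (by decide)).trans e13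
      have gl : s₂.mem (s₂.reg 20) = cl[i] := by rw [g20, gm, hmem i hi]
      refine WP.mono (wp_literalTest hb₂ ⟨g0, g1, g2⟩ (n := n) ?_ ?_) le_rfl ?_
      · rw [gl]
        exact hn _ (List.getElem_mem hi)
      · lia
      · rintro s₃ - - ⟨k20, km, k22⟩
        refine ⟨by rw [k20, g20]; lia, km.trans gm, ?_⟩
        have hF : Falsified (s.reg 12) (s.reg 13) (cl.take (i + 1)) ↔
            Falsified (s.reg 12) (s.reg 13) (cl.take i) ∧ ¬ LitTrue (s.reg 12) (s.reg 13) cl[i] := by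
          rw [List.take_succ_eq_append_getElem hi]
          simp only [Falsified, List.forall_mem_append, List.forall_mem_singleton]
        rw [k22, g22, gl, g12, g13]
        simp only [hF]
        split_ifs <;> simp_all
    · rintro s₂ - - ⟨g20, gm, g22⟩
      exact ⟨g20, gm, by simpa using g22⟩

/-- Write the pair of the numbers in the registers `10` and `21` if the current clause is
falsified. -/
def pairProg : Prog :=
  .seq clauseTest
    (block [.cond 22
        (block [.store 9 10, .arith .add 9 9 1, .store 9 21, .arith .add 9 9 1]) .skip,
      .arith .add 21 21 1])

/-- The number of steps in which one pair is processed. -/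
def pairSteps (k n : ℕ) : ℕ := k * (3 * n + 16) + 15

theorem wp_pairProg {B n k D : ℕ} {s : State} (hs : s.Bdd B) (hc : s.Consts)
    {cs : List (List ℕ)} (hk : ∀ c ∈ cs, c.length ≤ k) (hn : ∀ c ∈ cs, ∀ l ∈ c, l / 2 ≤ n)
    {out : List ℕ} (hm : s.mem = memOf out D (clauseWords cs)) (h9 : s.reg 9 = out.length)
    {v : ℕ} (hv : v < cs.length) (h21 : s.reg 21 = v)
    (h20 : s.reg 20 = D + (clauseWords (cs.take v)).length)
    (hD : out.length + 2 ≤ D) (hB : D + (clauseWords cs).length + 1 < B) (hvB : v + 1 < B) :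
    WP B pairProg (pairSteps k n)
      (fun s' => s'.reg 20 = D + (clauseWords (cs.take (v + 1))).length ∧ s'.reg 21 = v + 1 ∧
        ∃ out', out' = out ++ (if Falsified (s.reg 12) (s.reg 13) (cs.getD v [])
            then [s.reg 10, v] else []) ∧
          s'.mem = memOf out' D (clauseWords cs) ∧ s'.reg 9 = out'.length) s := by
  have hmem := List.getElem_mem hv
  have hlen : (clauseWords (cs.take v)).length + 1 + cs[v].length ≤ (clauseWords cs).length := by
    rw [clauseWords_split hv]
    simp
    lia
  refine WP.mono (WP.seq (T' := 8) (wp_clauseTest hs hc (hk _ hmem) (hn _ hmem) ?_ ?_ ?_) ?_)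
    (by simp only [pairSteps]; lia) (fun _ _ _ h => h)
  · rw [hm, h20, memOf_add, clauseWords_split hv]
    simp
  · intro i hi
    rw [hm, h20, add_assoc, add_assoc, memOf_add, clauseWords_split hv]
    simp only [List.getD_eq_getElem?_getD]
    rw [List.getElem?_append_right (by lia), List.getElem?_append_left (by simp; lia)]
    simp [show ∀ a : ℕ, a + (1 + i) - a = i + 1 by lia, hi]
  · lia
  · rintro s₁ hb₁ hf₁ ⟨g20, gm, g22⟩
    have e1 : s₁.reg 1 = 1 := (hf₁ 1 (by decide)).trans hc.2.1
    have e9 : s₁.reg 9 = out.length := (hf₁ 9 (by decide)).trans h9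
    have e10 : s₁.reg 10 = s.reg 10 := hf₁ 10 (by decide)
    have e21 : s₁.reg 21 = v := (hf₁ 21 (by decide)).trans h21
    rw [h20, add_assoc, add_assoc, ← add_assoc _ 1, ← length_clauseWords_take_succ hv] at g20
    have hgetD : cs.getD v [] = cs[v] := by simp [hv]
    rw [hgetD]
    by_cases hF : Falsified (s.reg 12) (s.reg 13) cs[v]
    · refine WP.straight hb₁ (by decide) ?_ ?_
      · simp [g22, hF, e1, e9, e21]
        lia
      · simp [g22, hF, e1, e9, e10, e21, g20, gm, hm]
        rw [update_memOf _ (by lia)]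
        have := update_memOf (out := out ++ [s.reg 10]) (D := D) (clauseWords cs) (by simp; lia) v
        simpa using this
    · refine WP.straight hb₁ (by decide) ?_ ?_
      · simp [g22, hF, e1, e21]
        lia
      · simp [g22, hF, e1, e9, e21, g20, gm, hm]

/-- Write the pairs of the row with parameters in the registers `10`, `11`, `12`, `13`. -/
def rowProg : Prog :=
  .seq (block [.arith .add 17 11 0, .arith .add 20 7 0, .const 21 0]) (forLoop 17 pairProg)

/-- The number of steps in which one row is processed. -/
def rowSteps (k n K : ℕ) : ℕ := K * (pairSteps k n + 2) + 5

theorem wp_rowProg {B n k D : ℕ} {s : State} (hs : s.Bdd B) (hc : s.Consts)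
    {cs : List (List ℕ)} (hk : ∀ c ∈ cs, c.length ≤ k) (hn : ∀ c ∈ cs, ∀ l ∈ c, l / 2 ≤ n)
    {out : List ℕ} (hm : s.mem = memOf out D (clauseWords cs)) (h9 : s.reg 9 = out.length)
    (h7 : s.reg 7 = D) (h11 : s.reg 11 ≤ cs.length)
    (hD : out.length + 2 * s.reg 11 ≤ D) (hB : D + (clauseWords cs).length + 1 < B) :
    WP B rowProg (rowSteps k n cs.length)
      (fun s' => ∃ out', out' = out ++
          pairWords (rowPairs cs (s.reg 10) (s.reg 11) (s.reg 12) (s.reg 13)) ∧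
          s'.mem = memOf out' D (clauseWords cs) ∧ s'.reg 9 = out'.length) s := by
  obtain ⟨h0, h1, h2⟩ := hc
  have hVB := hs.1 11
  refine WP.mono (WP.seq (T := 4) (T' := s.reg 11 * (pairSteps k n + 2) + 1)
    (R := fun s' => s'.reg 17 = s.reg 11 ∧ s'.reg 20 = D ∧ s'.reg 21 = 0 ∧ s'.mem = s.mem)
    ?_ ?_) (by simp only [rowSteps]; nlinarith) (fun _ _ _ h => h)
  · refine WP.straight hs (by decide) ?_ ?_
    · simp [h0, h7]
      lia
    · simp [h0, h7]
  · rintro s₁ hb₁ hf₁ ⟨e17, e20, e21, em⟩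
    have e0 : s₁.reg 0 = 0 := (hf₁ 0 (by decide)).trans h0
    have e1 : s₁.reg 1 = 1 := (hf₁ 1 (by decide)).trans h1
    have e2 : s₁.reg 2 = 2 := (hf₁ 2 (by decide)).trans h2
    have e9 : s₁.reg 9 = out.length := (hf₁ 9 (by decide)).trans h9
    have e10 : s₁.reg 10 = s.reg 10 := hf₁ 10 (by decide)
    have e12 : s₁.reg 12 = s.reg 12 := hf₁ 12 (by decide)
    have e13 : s₁.reg 13 = s.reg 13 := hf₁ 13 (by decide)
    refine WP.mono (WP.forLoop (I := fun i s' =>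
      s'.reg 20 = D + (clauseWords (cs.take i)).length ∧ s'.reg 21 = i ∧
        ∃ out', out' = out ++
          pairWords (rowPairs cs (s.reg 10) i (s.reg 12) (s.reg 13)) ∧
          s'.mem = memOf out' D (clauseWords cs) ∧ s'.reg 9 = out'.length)
      hb₁ (by decide) (by decide) (by decide) e1 e17 ?_ ?_ ?_) le_rfl ?_
    · exact ⟨by simp [e20, clauseWords], e21, out, by simp [rowPairs, pairWords], em.trans hm, e9⟩
    · simp
    · rintro i s₂ hi hb₂ hf₂ ⟨g20, g21, out', hout', gm, g9⟩
      have g0 : s₂.reg 0 = 0 := (hf₂ 0 (by decide)).trans e0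
      have g1 : s₂.reg 1 = 1 := (hf₂ 1 (by decide)).trans e1
      have g2 : s₂.reg 2 = 2 := (hf₂ 2 (by decide)).trans e2
      have g10 : s₂.reg 10 = s.reg 10 := (hf₂ 10 (by decide)).trans e10
      have g12 : s₂.reg 12 = s.reg 12 := (hf₂ 12 (by decide)).trans e12
      have g13 : s₂.reg 13 = s.reg 13 := (hf₂ 13 (by decide)).trans e13
      have hl : out'.length ≤ out.length + 2 * i := by
        rw [hout', List.length_append, length_pairWords]
        have := length_rowPairs_le cs (s.reg 10) i (s.reg 12) (s.reg 13)
        lia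
      refine WP.mono (wp_pairProg hb₂ ⟨g0, g1, g2⟩ hk hn gm g9 (by lia) g21 g20 (by lia) hB
        (by lia)) le_rfl ?_
      rintro s₃ - - ⟨k20, k21, out'', hout'', km, k9⟩
      refine ⟨k20, k21, out'', ?_, km, k9⟩
      rw [hout'', hout', rowPairs_succ, pairWords_append, g10, g12, g13, List.append_assoc]
      split_ifs <;> simp [pairWords]
    · rintro s₂ - - ⟨-, -, h⟩
      exact h

/-- Write the pairs of as many rows as register `16` says. -/
def rowsProg : Prog :=
  forLoop 16 (.seq rowProg (block [.arith .add 10 10 1, .arith .add 11 11 15,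
    .arith .add 12 12 14, .arith .sub 13 13 14]))

/-- Between rows the masks change by the fixed amount `d`, so no mask is computed from scratch. The
parameters are also updated after the last row, which is why the bounds `huB`, `hVB` and `hPB`
involve `cnt` itself. -/
theorem wp_rowsProg {B n k D : ℕ} {s : State} (hs : s.Bdd B) (hc : s.Consts)
    {cs : List (List ℕ)} (hk : ∀ c ∈ cs, c.length ≤ k) (hn : ∀ c ∈ cs, ∀ l ∈ c, l / 2 ≤ n)
    {out : List ℕ} (hm : s.mem = memOf out D (clauseWords cs)) (h9 : s.reg 9 = out.length)
    (h7 : s.reg 7 = D) {cnt u V dv P Q d : ℕ} (h16 : s.reg 16 = cnt) (h10 : s.reg 10 = u)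
    (h11 : s.reg 11 = V) (h15 : s.reg 15 = dv) (h12 : s.reg 12 = P) (h13 : s.reg 13 = Q)
    (h14 : s.reg 14 = d) (hV : ∀ i < cnt, V + i * dv ≤ cs.length)
    (hD : out.length + 2 * (cnt * cs.length) ≤ D) (hB : D + (clauseWords cs).length + 1 < B)
    (huB : u + cnt < B) (hVB : V + cnt * dv < B) (hPB : P + cnt * d < B) :
    WP B rowsProg (cnt * (rowSteps k n cs.length + 7) + 1)
      (fun s' => s'.reg 10 = u + cnt ∧ s'.reg 11 = V + cnt * dv ∧
        ∃ out', out' = out ++ pairWords (rowsPairs cs cnt u V dv P Q d) ∧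
          s'.mem = memOf out' D (clauseWords cs) ∧ s'.reg 9 = out'.length) s := by
  obtain ⟨h0, h1, h2⟩ := hc
  have hQB : Q < B := h13 ▸ hs.1 13
  refine WP.mono (WP.forLoop (T := rowSteps k n cs.length + 5) (I := fun i s' =>
      s'.reg 10 = u + i ∧ s'.reg 11 = V + i * dv ∧ s'.reg 12 = P + i * d ∧
      s'.reg 13 = Q - i * d ∧
        ∃ out', out' = out ++ pairWords (rowsPairs cs i u V dv P Q d) ∧
          s'.mem = memOf out' D (clauseWords cs) ∧ s'.reg 9 = out'.length)
      hs (by decide) (by decide) (by decide) h1 h16 ?_ ?_ ?_) le_rfl ?_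
  · simp [h10, h11, h12, h13, hm, h9, rowsPairs, pairWords]
  · simp
  · rintro i s₁ hi hb₁ hf₁ ⟨e10, e11, e12, e13, out', hout', em, e9⟩
    have e0 : s₁.reg 0 = 0 := (hf₁ 0 (by decide)).trans h0
    have e1 : s₁.reg 1 = 1 := (hf₁ 1 (by decide)).trans h1
    have e2 : s₁.reg 2 = 2 := (hf₁ 2 (by decide)).trans h2
    have e7 : s₁.reg 7 = D := (hf₁ 7 (by decide)).trans h7
    have e14 : s₁.reg 14 = d := (hf₁ 14 (by decide)).trans h14
    have e15 : s₁.reg 15 = dv := (hf₁ 15 (by decide)).trans h15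
    have hVi := hV i hi
    have hl : out'.length + 2 * (V + i * dv) ≤ D := by
      rw [hout', List.length_append, length_pairWords]
      have h1 : (rowsPairs cs i u V dv P Q d).length ≤ i * cs.length :=
        length_rowsPairs_le fun j hj => hV j (by lia)
      have h2 : (i + 1) * cs.length ≤ cnt * cs.length := Nat.mul_le_mul_right _ hi
      rw [add_mul] at h2
      lia
    refine WP.mono (WP.seq (wp_rowProg hb₁ ⟨e0, e1, e2⟩ hk hn em e9 e7 (by lia)
      (by rw [e11]; exact hl) hB) ?_) le_rfl (fun _ _ _ h => h)
    rintro s₂ hb₂ hf₂ ⟨out'', hout'', gm, g9⟩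
    have g1 : s₂.reg 1 = 1 := (hf₂ 1 (by decide)).trans e1
    have g10 : s₂.reg 10 = u + i := (hf₂ 10 (by decide)).trans e10
    have g11 : s₂.reg 11 = V + i * dv := (hf₂ 11 (by decide)).trans e11
    have g12 : s₂.reg 12 = P + i * d := (hf₂ 12 (by decide)).trans e12
    have g13 : s₂.reg 13 = Q - i * d := (hf₂ 13 (by decide)).trans e13
    have g14 : s₂.reg 14 = d := (hf₂ 14 (by decide)).trans e14
    have g15 : s₂.reg 15 = dv := (hf₂ 15 (by decide)).trans e15
    refine WP.straight hb₂ (by decide) ?_ ?_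
    · have h1 : (i + 1) * dv ≤ cnt * dv := Nat.mul_le_mul_right _ hi
      have h2 : (i + 1) * d ≤ cnt * d := Nat.mul_le_mul_right _ hi
      rw [add_mul, one_mul] at h1 h2
      simp [g1, g10, g11, g12, g13, g14, g15]
      lia
    · simp [g1, g10, g11, g12, g13, g14, g15, gm, g9, add_mul, add_assoc, Nat.sub_sub]
      rw [hout'', hout', rowsPairs_succ, pairWords_append, e10, e11, e12, e13, List.append_assoc]
      simp
  · rintro s₁ - - ⟨g10, g11, -, -, h⟩
    exact ⟨g10, g11, h⟩

end RAM

/-! ### Preparing the parameters and the memory. -/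

namespace RAM

/-- On a formula with `n` variables and `M` clauses with at most `k` literals each, compute the
numbers `M + 2`, `2 ^ (n / 2)` and `2 ^ (n - n / 2)`, the number of vertices, and the address of the
working copy of the formula. -/
def setupProg (k : ℕ) : Prog :=
  .seq (block [.const 1 1, .const 2 2, .load 3 0, .load 4 1, .const 25 (k + 1),
      .arith .mul 8 4 25, .arith .add 4 4 2, .arith .div 19 3 2, .const 5 1])
    (.seq (forLoop 19 (.arith .add 5 5 5))
      (.seq (block [.arith .div 19 3 2, .arith .add 19 19 19, .arith .sub 19 3 19,
          .arith .mul 6 5 19, .arith .add 6 6 5])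
        (block [.arith .add 26 4 5, .arith .add 26 26 6, .arith .mul 7 26 4, .arith .add 7 7 7,
          .arith .add 7 7 2, .arith .add 7 7 8, .const 20 2, .arith .add 22 7 2,
          .arith .add 22 22 2, .arith .add 18 8 0])))

/-- The factor `n - (n / 2 + n / 2)` is the parity of `n`: the upper half has as many assignments as
the lower one for even `n`, and twice as many for odd `n`. -/
theorem two_pow_sub_half (n : ℕ) :
    2 ^ (n / 2) * (n - (n / 2 + n / 2)) + 2 ^ (n / 2) = 2 ^ (n - n / 2) := by
  rcases Nat.even_or_odd' n with ⟨m, rfl | rfl⟩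
  · rw [show 2 * m / 2 = m by lia, show 2 * m - (m + m) = 0 by lia, show 2 * m - m = m by lia]
    simp
  · rw [show (2 * m + 1) / 2 = m by lia, show 2 * m + 1 - (m + m) = 1 by lia,
      show 2 * m + 1 - m = m + 1 by lia]
    ring

/-- Below `D` there is room for the two header words and for `N * (M + 2)` pairs, which bounds the
number of edges. The summand `M * (k + 1)` of `D` makes the formula and its copy disjoint, and the
copy starts at `D + 4` to leave four words for the two unit clauses. -/
theorem wp_setupProg {B n M k D N H H' : ℕ} {rest : List ℕ}
    (hs : (initial (n :: M :: rest)).Bdd B)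
    (hH : H = 2 ^ (n / 2)) (hH' : H' = 2 ^ (n - n / 2)) (hN : N = M + 2 + H + H')
    (hD : D = 2 * (N * (M + 2)) + 2 + M * (k + 1)) (hkB : k + 1 < B) (hDB : D + 4 < B) :
    WP B (setupProg k) (2 * n + 40)
      (fun s => s.Consts ∧ s.reg 3 = n ∧ s.reg 4 = M + 2 ∧ s.reg 5 = H ∧ s.reg 6 = H' ∧
        s.reg 7 = D ∧ s.reg 8 = M * (k + 1) ∧ s.reg 26 = N ∧ s.reg 18 = M * (k + 1) ∧
        s.reg 20 = 2 ∧ s.reg 22 = D + 4 ∧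
        s.mem = fun i => (n :: M :: rest).getD i 0) (initial (n :: M :: rest)) := by
  have hNB : N ≤ N * (M + 2) := Nat.le_mul_of_pos_right _ (by lia)
  refine WP.mono (WP.seq (T := 10) (T' := 2 * n + 30) (R := fun s => s.Consts ∧ s.reg 3 = n ∧
    s.reg 4 = M + 2 ∧ s.reg 8 = M * (k + 1) ∧ s.reg 19 = n / 2 ∧ s.reg 5 = 1 ∧
    s.mem = fun i => (n :: M :: rest).getD i 0) ?_ ?_) (by lia) (fun _ _ _ h => h)
  · refine WP.straight hs (by simp [Prog.steps]) ?_ ?_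
    · have : n < B := hs.2 0
      simp [initial]
      lia
    · simp [initial, State.Consts]
  · rintro s₁ hb₁ hf₁ ⟨⟨e0, e1, e2⟩, e3, e4, e8, e19, e5, em⟩
    refine WP.mono (WP.seq (T := n / 2 * (1 + 2) + 1) (T' := 18) (R := fun s => s.reg 5 = H ∧
      s.mem = fun i => (n :: M :: rest).getD i 0) ?_ ?_) (by lia) (fun _ _ _ h => h)
    · rw [hH]
      refine WP.forLoop (I := fun i s => s.reg 5 = 2 ^ i ∧
        s.mem = fun i => (n :: M :: rest).getD i 0) hb₁ (by decide) (by decide) (by decide) e1 e19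
        ⟨e5, em⟩ (by simp) ?_
      rintro i s₂ hi hb₂ hf₂ ⟨g5, gm⟩
      have hle : 2 ^ (i + 1) ≤ H := hH ▸ Nat.pow_le_pow_right (by lia) hi
      rw [pow_succ] at hle
      refine WP.straight hb₂ (by decide) ?_ ?_
      · simp [g5]
        lia
      · simp [g5, gm, pow_succ, mul_two]
    · rintro s₂ hb₂ hf₂ ⟨g5, gm⟩
      have g0 : s₂.reg 0 = 0 := (hf₂ 0 (by decide)).trans e0
      have g1 : s₂.reg 1 = 1 := (hf₂ 1 (by decide)).trans e1
      have g2 : s₂.reg 2 = 2 := (hf₂ 2 (by decide)).trans e2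
      have g3 : s₂.reg 3 = n := (hf₂ 3 (by decide)).trans e3
      have g4 : s₂.reg 4 = M + 2 := (hf₂ 4 (by decide)).trans e4
      have g8 : s₂.reg 8 = M * (k + 1) := (hf₂ 8 (by decide)).trans e8
      have hHH := two_pow_sub_half n
      rw [← hH, ← hH'] at hHH
      refine WP.mono (WP.seq (T := 6) (T' := 12) (R := fun s => s.reg 6 = H' ∧
        s.mem = fun i => (n :: M :: rest).getD i 0) ?_ ?_) (by lia) (fun _ _ _ h => h)
      · refine WP.straight hb₂ (by decide) ?_ ?_
        · have : n < B := hs.2 0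
          simp [g2, g3, g5]
          lia
        · simp [g2, g3, g5, hHH, gm]
      · rintro s₃ hb₃ hf₃ ⟨k6, km⟩
        have k0 : s₃.reg 0 = 0 := (hf₃ 0 (by decide)).trans g0
        have k1 : s₃.reg 1 = 1 := (hf₃ 1 (by decide)).trans g1
        have k2 : s₃.reg 2 = 2 := (hf₃ 2 (by decide)).trans g2
        have k3 : s₃.reg 3 = n := (hf₃ 3 (by decide)).trans g3
        have k4 : s₃.reg 4 = M + 2 := (hf₃ 4 (by decide)).trans g4
        have k5 : s₃.reg 5 = H := (hf₃ 5 (by decide)).trans g5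
        have k8 : s₃.reg 8 = M * (k + 1) := (hf₃ 8 (by decide)).trans g8
        refine WP.straight hb₃ (by decide) ?_ ?_
        · simp [k0, k2, k4, k5, k6, k8, ← hN]
          lia
        · simp [State.Consts, k0, k1, k2, k3, k4, k5, k6, k8, ← hN, km]
          lia

/-- Move as many words as register `18` says from address `2` to the address in register `22`. -/
def moveProg : Prog :=
  forLoop 18 (block [.load 24 20, .store 22 24, .store 20 0, .arith .add 20 20 1,
    .arith .add 22 22 1])

/-- The memory after the first `i` words have been moved. -/
def movedMem (g : ℕ → ℕ) (D i a : ℕ) : ℕ :=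
  if 2 ≤ a ∧ a < 2 + i then 0 else if D + 4 ≤ a ∧ a < D + 4 + i then g (a - (D + 2)) else g a

theorem movedMem_succ {g : ℕ → ℕ} {D i : ℕ} (h : 2 + i ≤ D) :
    Function.update (Function.update (movedMem g D i) (D + 4 + i) (g (2 + i))) (2 + i) 0 =
      movedMem g D (i + 1) := by
  funext a
  simp only [Function.update_apply, movedMem]
  split_ifs <;> first | rfl | lia | (congr 1; lia)

theorem wp_moveProg {B D L : ℕ} {s : State} (hs : s.Bdd B) (hc : s.Consts)
    (h18 : s.reg 18 = L) (h20 : s.reg 20 = 2) (h22 : s.reg 22 = D + 4) (hL : L + 2 ≤ D)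
    (hB : D + 4 + L < B) :
    WP B moveProg (L * 8 + 1) (fun s' => s'.mem = movedMem s.mem D L) s := by
  obtain ⟨h0, h1, h2⟩ := hc
  refine WP.mono (WP.forLoop (T := 6) (I := fun i s' => s'.reg 20 = 2 + i ∧
    s'.reg 22 = D + 4 + i ∧ s'.mem = movedMem s.mem D i) hs (by decide) (by decide) (by decide)
    h1 h18 ?_ (by simp) ?_) le_rfl (fun _ _ _ h => h.2.2)
  · refine ⟨h20, h22, ?_⟩
    funext a
    simp only [movedMem]
    split_ifs <;> first | rfl | lia
  · rintro i s₁ hi hb₁ hf₁ ⟨e20, e22, em⟩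
    have e0 : s₁.reg 0 = 0 := (hf₁ 0 (by decide)).trans h0
    have e1 : s₁.reg 1 = 1 := (hf₁ 1 (by decide)).trans h1
    refine WP.straight hb₁ (by decide) ?_ ?_
    · simp [e0, e1, e20, e22]
      lia
    · have hg : movedMem s.mem D i (2 + i) = s.mem (2 + i) := by
        simp only [movedMem]
        rw [if_neg (by lia), if_neg (by lia)]
      simp [e0, e1, e20, e22, em, hg, movedMem_succ (show 2 + i ≤ D by lia)]
      lia

/-- Write two additional clauses in front of the working copy of the formula, and the number of
vertices to address `0`; prepare the rows of the clause vertices. -/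
def headerProg : Prog :=
  .seq (block [.arith .add 20 7 0, .store 20 1, .arith .add 20 20 1, .arith .add 25 3 3,
      .arith .add 25 25 1, .store 20 25, .arith .add 20 20 1, .store 20 1, .arith .add 20 20 1,
      .arith .sub 25 25 1, .store 20 25, .store 0 26, .store 1 0])
    (block [.arith .add 9 2 0, .const 10 0, .const 11 0, .const 12 0, .const 13 0, .const 14 0,
      .const 15 1, .arith .add 16 4 0])

theorem wp_headerProg {B D N n M L : ℕ} {rest : List ℕ} {s : State} (hs : s.Bdd B) (hc : s.Consts)
    (h3 : s.reg 3 = n) (h4 : s.reg 4 = M + 2) (h7 : s.reg 7 = D) (h26 : s.reg 26 = N)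
    (hm : s.mem = movedMem (fun i => (n :: M :: rest).getD i 0) D L) (hL : rest.length ≤ L)
    (hLD : L + 2 ≤ D) (hDB : D + 4 < B) (hnB : n + n + 1 < B) :
    WP B headerProg 23 (fun s' => s'.reg 9 = 2 ∧ s'.reg 10 = 0 ∧ s'.reg 11 = 0 ∧ s'.reg 12 = 0 ∧
      s'.reg 13 = 0 ∧ s'.reg 14 = 0 ∧ s'.reg 15 = 1 ∧ s'.reg 16 = M + 2 ∧
      s'.mem = memOf [N, 0] D (1 :: (2 * n + 1) :: 1 :: (2 * n) :: rest)) s := by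
  obtain ⟨h0, h1, h2⟩ := hc
  -- The number `L` of moved words only bounds the length of the formula from above; the surplus
  -- words are 0 before and after the move.
  have hz : ∀ b, L ≤ b → rest[b]?.getD 0 = 0 := fun b hb => by
    rw [List.getElem?_eq_none (by lia), Option.getD_none]
  refine WP.mono (WP.seq (T := 14) (T' := 9) (R := fun s' =>
    s'.mem = memOf [N, 0] D (1 :: (2 * n + 1) :: 1 :: (2 * n) :: rest)) ?_ ?_) le_rfl
    (fun _ _ _ h => h)
  · refine WP.straight hs (by decide) ?_ ?_
    · simp [h0, h1, h3, h7]
      lia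
    · simp only [block, Prog.eval, ArithOp.eval, setReg_reg, setReg_mem, setMem_reg, setMem_mem]
      simp only [Nat.reduceEqDiff, if_true, if_false, h0, h1, h3, h7, h26, hm]
      funext a
      simp only [Function.update_apply, memOf, movedMem]
      rcases lt_or_ge a D with ha | ha
      · rcases a with _ | _ | a
        · simp
          lia
        · simp
          lia
        · simp [ha]
          split_ifs <;> first | rfl | lia | (apply hz; lia)
      · obtain ⟨b, rfl⟩ := Nat.exists_eq_add_of_le ha
        rcases b with _ | _ | _ | _ | b
        · simp
          lia
        · simp
          lia
        · simp
        · simp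
          lia
        · simp
          split_ifs
          all_goals try lia
          · rw [show D + (b + 1 + 1 + 1 + 1) - (D + 2) = b + 1 + 1 by lia]
            rfl
          · rw [hz b (by lia), show D + (b + 1 + 1 + 1 + 1) = D + b + 1 + 1 + 1 + 1 by lia]
            exact hz _ (by lia)
  · rintro s₁ hb₁ hf₁ em
    have e0 : s₁.reg 0 = 0 := (hf₁ 0 (by decide)).trans h0
    have e1 : s₁.reg 1 = 1 := (hf₁ 1 (by decide)).trans h1
    have e2 : s₁.reg 2 = 2 := (hf₁ 2 (by decide)).trans h2
    have e4 : s₁.reg 4 = M + 2 := (hf₁ 4 (by decide)).trans h4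
    refine WP.straight hb₁ (by decide) ?_ ?_
    · have := hb₁.1 4
      simp [e0, e2, e4]
      lia
    · simp [e0, e2, e4, em]

end RAM

/-! ### The edge list and the complete reduction program. -/

/-- All pairs that the reduction writes, for clauses `cs` and for `H` and `H'` assignments of the
two halves of the variables. -/
def edgePairs (cs : List (List ℕ)) (H H' : ℕ) : List (ℕ × ℕ) :=
  rowsPairs cs cs.length 0 0 1 0 0 0 ++ rowsPairs cs H cs.length cs.length 0 0 (H * H' + H - 1) 1 ++
    rowsPairs cs H' (cs.length + H) cs.length 0 (H * H') ((H' - 1) * H) H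

theorem length_edgePairs_le (cs : List (List ℕ)) (H H' : ℕ) :
    (edgePairs cs H H').length ≤ (cs.length + H + H') * cs.length := by
  simp only [edgePairs, List.length_append, add_mul]
  refine add_le_add (add_le_add ?_ ?_) ?_
  · exact length_rowsPairs_le fun i hi => by lia
  · exact length_rowsPairs_le fun i hi => by lia
  · exact length_rowsPairs_le fun i hi => by lia

namespace RAM

/-- Write the pairs for the clause vertices and for the assignments of both halves. -/
def allRowsProg : Prog :=
  .seq rowsProg
    (.seq (block [.arith .add 16 5 0, .const 15 0, .const 12 0, .arith .mul 13 5 6,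
        .arith .add 13 13 5, .arith .sub 13 13 1, .const 14 1])
      (.seq rowsProg
        (.seq (block [.arith .add 16 6 0, .arith .mul 12 5 6, .arith .sub 13 6 1,
            .arith .mul 13 13 5, .arith .add 14 5 0])
          rowsProg)))

/-- The row number and the column bound carry over from batch to batch: the clause rows have bounds
`0, 1, 2, …`, which stop at the number of clauses, the constant bound of the later batches. -/
theorem wp_allRowsProg {B n k D N H H' : ℕ} {s : State} (hs : s.Bdd B) (hc : s.Consts)
    {cs : List (List ℕ)} (hk : ∀ c ∈ cs, c.length ≤ k) (hn : ∀ c ∈ cs, ∀ l ∈ c, l / 2 ≤ n)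
    (hm : s.mem = memOf [N, 0] D (clauseWords cs)) (hN : N = cs.length + H + H')
    (h5 : s.reg 5 = H) (h6 : s.reg 6 = H') (h7 : s.reg 7 = D) (h9 : s.reg 9 = 2)
    (h10 : s.reg 10 = 0) (h11 : s.reg 11 = 0) (h12 : s.reg 12 = 0) (h13 : s.reg 13 = 0)
    (h14 : s.reg 14 = 0) (h15 : s.reg 15 = 1) (h16 : s.reg 16 = cs.length)
    (hD : 2 + 2 * (N * cs.length) ≤ D) (hB : D + (clauseWords cs).length + N + 1 < B)
    (hHB : 2 * (H * H') + H < B) :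
    WP B allRowsProg (N * (rowSteps k n cs.length + 7) + 25)
      (fun s' => ∃ out, out = N :: 0 :: pairWords (edgePairs cs H H') ∧
          s'.mem = memOf out D (clauseWords cs) ∧ s'.reg 9 = out.length) s := by
  obtain ⟨h0, h1, h2⟩ := hc
  have hD' : 2 + (2 * (cs.length * cs.length) + 2 * (H * cs.length) + 2 * (H' * cs.length)) ≤ D := by
    rw [hN] at hD
    linarith
  refine WP.mono (WP.seq (wp_rowsProg hs ⟨h0, h1, h2⟩ hk hn hm (by simpa using h9) h7 h16 h10 h11
    h15 h12 h13 h14 (by lia) (by simp; lia) (by lia) (by lia) (by lia) (by lia)) ?_)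
    (T := cs.length * (rowSteps k n cs.length + 7) + 1 + (8 +
      ((H * (rowSteps k n cs.length + 7) + 1) + (6 + (H' * (rowSteps k n cs.length + 7) + 1)))))
    (by rw [hN]; linarith) (fun _ _ _ h => h)
  rintro s₁ hb₁ hf₁ ⟨e10, e11, out₁, ho₁, em, e9⟩
  have e0 : s₁.reg 0 = 0 := (hf₁ 0 (by decide)).trans h0
  have e1 : s₁.reg 1 = 1 := (hf₁ 1 (by decide)).trans h1
  have e2 : s₁.reg 2 = 2 := (hf₁ 2 (by decide)).trans h2
  have e5 : s₁.reg 5 = H := (hf₁ 5 (by decide)).trans h5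
  have e6 : s₁.reg 6 = H' := (hf₁ 6 (by decide)).trans h6
  have e7 : s₁.reg 7 = D := (hf₁ 7 (by decide)).trans h7
  have hl₁ : out₁.length ≤ 2 + 2 * (cs.length * cs.length) := by
    rw [ho₁, List.length_append, length_pairWords]
    have : (rowsPairs cs cs.length 0 0 1 0 0 0).length ≤ cs.length * cs.length :=
      length_rowsPairs_le fun i hi => by lia
    simp
    lia
  refine WP.seq (R := fun s' => s'.reg 16 = H ∧ s'.reg 15 = 0 ∧ s'.reg 12 = 0 ∧
    s'.reg 13 = H * H' + H - 1 ∧ s'.reg 14 = 1 ∧ s'.mem = s₁.mem) ?_ ?_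
  · refine WP.straight hb₁ (by decide) ?_ ?_
    · simp [e0, e1, e5, e6]
      lia
    · simp [e0, e1, e5, e6]
  rintro s₂ hb₂ hf₂ ⟨g16, g15, g12, g13, g14, gm⟩
  have g0 : s₂.reg 0 = 0 := (hf₂ 0 (by decide)).trans e0
  have g1 : s₂.reg 1 = 1 := (hf₂ 1 (by decide)).trans e1
  have g2 : s₂.reg 2 = 2 := (hf₂ 2 (by decide)).trans e2
  have g5 : s₂.reg 5 = H := (hf₂ 5 (by decide)).trans e5
  have g6 : s₂.reg 6 = H' := (hf₂ 6 (by decide)).trans e6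
  have g7 : s₂.reg 7 = D := (hf₂ 7 (by decide)).trans e7
  have g9 : s₂.reg 9 = out₁.length := (hf₂ 9 (by decide)).trans e9
  have g10 : s₂.reg 10 = cs.length := by rw [hf₂ 10 (by decide), e10, zero_add]
  have g11 : s₂.reg 11 = cs.length := by rw [hf₂ 11 (by decide), e11, zero_add, mul_one]
  refine WP.seq (wp_rowsProg hb₂ ⟨g0, g1, g2⟩ hk hn (gm.trans em) g9 g7 g16 g10 g11
    g15 g12 g13 g14 (by lia) (by lia) (by lia) (by lia) (by lia) (by lia)) ?_
  rintro s₃ hb₃ hf₃ ⟨k10, k11, out₂, ho₂, km, k9⟩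
  have k0 : s₃.reg 0 = 0 := (hf₃ 0 (by decide)).trans g0
  have k1 : s₃.reg 1 = 1 := (hf₃ 1 (by decide)).trans g1
  have k2 : s₃.reg 2 = 2 := (hf₃ 2 (by decide)).trans g2
  have k5 : s₃.reg 5 = H := (hf₃ 5 (by decide)).trans g5
  have k6 : s₃.reg 6 = H' := (hf₃ 6 (by decide)).trans g6
  have k7 : s₃.reg 7 = D := (hf₃ 7 (by decide)).trans g7
  have k15 : s₃.reg 15 = 0 := (hf₃ 15 (by decide)).trans g15
  have hl₂ : out₂.length ≤ 2 + 2 * (cs.length * cs.length) + 2 * (H * cs.length) := by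
    rw [ho₂, List.length_append, length_pairWords]
    have : (rowsPairs cs H cs.length cs.length 0 0 (H * H' + H - 1) 1).length ≤ H * cs.length :=
      length_rowsPairs_le fun i hi => by lia
    lia
  have hcomm : H' * H = H * H' := mul_comm _ _
  have hle : (H' - 1) * H ≤ H * H' := hcomm ▸ Nat.mul_le_mul_right _ (Nat.sub_le _ _)
  refine WP.seq (R := fun s' => s'.reg 16 = H' ∧ s'.reg 12 = H * H' ∧
    s'.reg 13 = (H' - 1) * H ∧ s'.reg 14 = H ∧ s'.mem = s₃.mem) ?_ ?_
  · refine WP.straight hb₃ (by decide) ?_ ?_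
    · simp [k0, k1, k5, k6]
      lia
    · simp [k0, k1, k5, k6]
  rintro s₄ hb₄ hf₄ ⟨q16, q12, q13, q14, qm⟩
  have q0 : s₄.reg 0 = 0 := (hf₄ 0 (by decide)).trans k0
  have q1 : s₄.reg 1 = 1 := (hf₄ 1 (by decide)).trans k1
  have q2 : s₄.reg 2 = 2 := (hf₄ 2 (by decide)).trans k2
  have q7 : s₄.reg 7 = D := (hf₄ 7 (by decide)).trans k7
  have q9 : s₄.reg 9 = out₂.length := (hf₄ 9 (by decide)).trans k9
  have q10 : s₄.reg 10 = cs.length + H := (hf₄ 10 (by decide)).trans k10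
  have q11 : s₄.reg 11 = cs.length := by rw [hf₄ 11 (by decide), k11, mul_zero, add_zero]
  have q15 : s₄.reg 15 = 0 := (hf₄ 15 (by decide)).trans k15
  refine WP.mono (wp_rowsProg hb₄ ⟨q0, q1, q2⟩ hk hn (qm.trans km) q9 q7 q16 q10 q11
    q15 q12 q13 q14 (by lia) (by lia) (by lia) (by lia) (by lia) (by lia)) le_rfl ?_
  rintro s₅ - - ⟨-, -, out, ho, hm', h9'⟩
  refine ⟨out, ?_, hm', h9'⟩
  rw [ho, ho₂, ho₁, edgePairs, pairWords_append, pairWords_append]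
  simp

/-- Set all registers below `m` to `0`. -/
def clearRegs : ℕ → Prog
  | 0 => .skip
  | m + 1 => .seq (.const m 0) (clearRegs m)

theorem steps_clearRegs (m : ℕ) : (clearRegs m).steps = m + 1 := by
  induction m with
  | zero => rfl
  | succ m ih => simp [clearRegs, Prog.steps, ih]; lia

theorem safe_clearRegs {B : ℕ} (hB : 0 < B) (m : ℕ) (s : State) : (clearRegs m).Safe B s := by
  induction m generalizing s with
  | zero => trivial
  | succ m ih => exact ⟨hB, ih _⟩

theorem eval_clearRegs (m : ℕ) (s : State) :
    ((clearRegs m).eval s).mem = s.mem ∧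
      ∀ r, ((clearRegs m).eval s).reg r = if r < m then 0 else s.reg r := by
  induction m generalizing s with
  | zero => simp [clearRegs]
  | succ m ih =>
    refine ⟨(ih _).1, fun r => ?_⟩
    rw [clearRegs, Prog.eval, (ih _).2]
    simp only [Prog.eval, setReg_reg]
    split_ifs <;> first | rfl | lia

/-- Write the number of pairs, and set the working memory and all registers to `0`. -/
def finishProg : Prog :=
  .seq (block [.arith .sub 25 9 2, .arith .div 25 25 2, .store 1 25, .arith .add 18 8 2,
      .arith .add 18 18 2, .arith .add 20 7 0])
    (.seq (forLoop 18 (block [.store 20 0, .arith .add 20 20 1])) (clearRegs 27))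

theorem wp_finishProg {B D N L : ℕ} {s : State} (hs : s.Bdd B) (hc : s.Consts) {w : List ℕ}
    {E : List (ℕ × ℕ)} (hm : s.mem = memOf (N :: 0 :: pairWords E) D w)
    (h7 : s.reg 7 = D) (h8 : s.reg 8 = L) (h9 : s.reg 9 = (N :: 0 :: pairWords E).length)
    (hw : w.length ≤ L + 4) (hD : 2 + 2 * E.length ≤ D) (hB : D + L + 5 < B) :
    WP B finishProg (L * 5 + 60) (fun s' => (∀ r < 27, s'.reg r = 0) ∧
      s'.mem = fun i => (N :: E.length :: pairWords E).getD i 0) s := by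
  obtain ⟨h0, h1, h2⟩ := hc
  rw [List.length_cons, List.length_cons, length_pairWords] at h9
  have hupd : Function.update s.mem 1 E.length = memOf (N :: E.length :: pairWords E) D w := by
    rw [hm]
    funext a
    simp only [Function.update_apply, memOf]
    rcases a with _ | _ | a
    · simp
    · simp
      lia
    · simp
  refine WP.mono (WP.seq (T := 7) (T' := (L + 4) * 5 + 1 + 28) (R := fun s' => s'.reg 18 = L + 4 ∧
    s'.reg 20 = D ∧ s'.mem = memOf (N :: E.length :: pairWords E) D w) ?_ ?_) (by lia)
    (fun _ _ _ h => h)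
  · refine WP.straight hs (by decide) ?_ ?_
    · simp [h0, h1, h2, h7, h8, h9]
      lia
    · simp [h0, h1, h2, h7, h8, h9, hupd]
  rintro s₁ hb₁ hf₁ ⟨e18, e20, em⟩
  have e0 : s₁.reg 0 = 0 := (hf₁ 0 (by decide)).trans h0
  have e1 : s₁.reg 1 = 1 := (hf₁ 1 (by decide)).trans h1
  refine WP.seq (WP.forLoop (T := 3) (I := fun i s' => s'.reg 20 = D + i ∧
    s'.mem = fun a => if D ≤ a ∧ a < D + i then 0 else memOf (N :: E.length :: pairWords E) D w a)
    hb₁ (by decide) (by decide) (by decide) e1 e18 ?_ (by simp) ?_) ?_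
  · refine ⟨e20, ?_⟩
    rw [em]
    funext a
    rw [if_neg (by lia)]
  · rintro i s₂ hi hb₂ hf₂ ⟨g20, gm⟩
    have g0 : s₂.reg 0 = 0 := (hf₂ 0 (by decide)).trans e0
    have g1 : s₂.reg 1 = 1 := (hf₂ 1 (by decide)).trans e1
    refine WP.straight hb₂ (by decide) ?_ ?_
    · simp [g0, g1, g20]
      lia
    · simp [g0, g1, g20, gm]
      refine ⟨by lia, ?_⟩
      funext a
      simp only [Function.update_apply]
      split_ifs <;> first | rfl | lia
  · rintro s₂ hb₂ hf₂ ⟨g20, gm⟩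
    refine WP.straight hb₂ (by rw [steps_clearRegs]) (safe_clearRegs (by lia) _ _) ?_
    obtain ⟨hmem, hreg⟩ := eval_clearRegs 27 s₂
    refine ⟨fun r hr => by rw [hreg, if_pos hr], ?_⟩
    rw [hmem, gm]
    funext a
    have hl := length_pairWords E
    simp only [memOf]
    split_ifs with h1 h2
    · rw [List.getD_eq_default _ _ (by simp; lia)]
    · rfl
    · rw [List.getD_eq_default _ _ (by lia), List.getD_eq_default _ _ (by simp; lia)]

/-- The reduction from `k`-SAT to the computation of the diameter. -/
def reductionProg (k : ℕ) : Prog :=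
  .seq (setupProg k) (.seq moveProg (.seq headerProg (.seq allRowsProg finishProg)))

/-- The number of steps of the reduction, for a formula with `n` variables and `M` clauses. -/
def reductionSteps (k n M N : ℕ) : ℕ :=
  N * (rowSteps k n (M + 2) + 7) + 13 * (M * (k + 1)) + 2 * n + 160

-- The parameter `k` enters the program only as a constant to be loaded, not as a register number,
-- so the finite check for `k = 0` covers all `k`.
set_option maxRecDepth 10000 in
theorem lt_of_mem_writes_reductionProg {k r : ℕ} (h : r ∈ (reductionProg k).writes) : r < 27 := by
  have : ∀ r ∈ (reductionProg 0).writes, r < 27 := by decide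
  exact this r h

theorem exec_reductionProg {B n k N H H' : ℕ} {cs cs' : List (List ℕ)}
    (hs : (initial (n :: cs.length :: clauseWords cs)).Bdd B)
    (hk : ∀ c ∈ cs, c.length ≤ k) (hn : ∀ c ∈ cs, ∀ l ∈ c, l / 2 ≤ n)
    (hcs' : cs' = [2 * n + 1] :: [2 * n] :: cs) (hH : H = 2 ^ (n / 2)) (hH' : H' = 2 ^ (n - n / 2))
    (hN : N = cs.length + 2 + H + H') (hk1 : 1 ≤ k)
    (hB : 3 * (N * (cs.length + 2)) + 2 * (cs.length * (k + 1)) + 3 * (H * H') + 2 * n + k + 20 < B) :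
    ∃ t ≤ reductionSteps k n cs.length N * (2 * B.size + 1),
      Exec (reductionProg k) (initial (n :: cs.length :: clauseWords cs))
        (initial (N :: (edgePairs cs' H H').length :: pairWords (edgePairs cs' H H'))) t := by
  set M := cs.length with hM
  have hlen : cs'.length = M + 2 := by simp [hcs', hM]
  obtain ⟨D, hD⟩ : ∃ D, D = 2 * (N * (M + 2)) + 2 + M * (k + 1) := ⟨_, rfl⟩
  have hNM : N ≤ N * (M + 2) := Nat.le_mul_of_pos_right _ (by lia)
  have hHN : H ≤ N := by lia
  have hwl : (clauseWords cs).length ≤ M * (k + 1) := by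
    rw [hM]
    clear * - hk
    induction cs with
    | nil => simp [clauseWords]
    | cons c cs ih =>
      have h1 := ih fun c hc => hk c (by simp [hc])
      have h2 := hk c (by simp)
      simp only [clauseWords, List.flatMap_cons, List.length_append, List.length_cons,
        add_mul] at h1 ⊢
      lia
  have hw' : clauseWords cs' = 1 :: (2 * n + 1) :: 1 :: (2 * n) :: clauseWords cs := by
    simp [hcs', clauseWords]
  have hw'l : (clauseWords cs').length = (clauseWords cs).length + 4 := by simp [hw']
  -- The added unit clauses obey the length bound because `1 ≤ k`.
  have hk' : ∀ c ∈ cs', c.length ≤ k := by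
    simp only [hcs', List.mem_cons]
    rintro c (rfl | rfl | hc)
    · simpa
    · simpa
    · exact hk c hc
  have hn' : ∀ c ∈ cs', ∀ l ∈ c, l / 2 ≤ n := by
    simp only [hcs', List.mem_cons]
    rintro c (rfl | rfl | hc)
    · simp
      lia
    · simp
    · exact hn c hc
  have key : WP B (reductionProg k) (reductionSteps k n M N)
      (fun s' => (∀ r < 27, s'.reg r = 0) ∧ s'.mem = fun i =>
        (N :: (edgePairs cs' H H').length :: pairWords (edgePairs cs' H H')).getD i 0)
      (initial (n :: M :: clauseWords cs)) := by
    refine WP.mono (WP.seq (wp_setupProg hs hH hH' hN hD (by lia) (by lia)) (T' :=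
      (M * (k + 1) * 8 + 1) + (23 + ((N * (rowSteps k n (M + 2) + 7) + 25) +
        (M * (k + 1) * 5 + 60)))) ?_)
      (by simp only [reductionSteps]; lia) (fun _ _ _ h => h)
    rintro s₁ hb₁ - ⟨ec, e3, e4, e5, e6, e7, e8, e26, e18, e20, e22, em⟩
    refine WP.seq (wp_moveProg hb₁ ec e18 e20 e22 (by lia) (by lia)) ?_
    rintro s₂ hb₂ hf₂ gm
    have g2 : s₂.Consts := by
      simpa only [State.Consts, hf₂ 0 (by decide), hf₂ 1 (by decide), hf₂ 2 (by decide)] using ec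
    have g3 := (hf₂ 3 (by decide)).trans e3
    have g4 := (hf₂ 4 (by decide)).trans e4
    have g5 := (hf₂ 5 (by decide)).trans e5
    have g6 := (hf₂ 6 (by decide)).trans e6
    have g7 := (hf₂ 7 (by decide)).trans e7
    have g8 := (hf₂ 8 (by decide)).trans e8
    have g26 := (hf₂ 26 (by decide)).trans e26
    rw [em] at gm
    refine WP.seq (wp_headerProg hb₂ g2 g3 g4 g7 g26 gm hwl (by lia) (by lia) (by lia)) ?_
    rintro s₃ hb₃ hf₃ ⟨k9, k10, k11, k12, k13, k14, k15, k16, km⟩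
    have k2 : s₃.Consts := by
      simpa only [State.Consts, hf₃ 0 (by decide), hf₃ 1 (by decide), hf₃ 2 (by decide)] using g2
    have k5 := (hf₃ 5 (by decide)).trans g5
    have k6 := (hf₃ 6 (by decide)).trans g6
    have k7 := (hf₃ 7 (by decide)).trans g7
    have k8 := (hf₃ 8 (by decide)).trans g8
    rw [← hw'] at km
    rw [← hlen] at k16
    refine WP.seq (WP.mono (wp_allRowsProg hb₃ k2 hk' hn' km (by rw [hlen]; exact hN) k5 k6 k7 k9
      k10 k11 k12 k13 k14 k15 k16 (by rw [hlen]; lia) (by lia) (by lia))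
      (by rw [hlen]) fun _ _ _ h => h) ?_
    rintro s₄ hb₄ hf₄ ⟨out, rfl, qm, q9⟩
    have q2 : s₄.Consts := by
      simpa only [State.Consts, hf₄ 0 (by decide), hf₄ 1 (by decide), hf₄ 2 (by decide)] using k2
    have q7 := (hf₄ 7 (by decide)).trans k7
    have q8 := (hf₄ 8 (by decide)).trans k8
    have hE := length_edgePairs_le cs' H H'
    rw [hlen, ← hN] at hE
    exact wp_finishProg hb₄ q2 qm q7 q8 q9 (by lia) (by lia) (by lia)
  obtain ⟨s', t, he, ht, -, hf, hreg, hmem⟩ := key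
  refine ⟨t, ht, ?_⟩
  convert he using 1
  have hr : s'.reg = fun _ => 0 := by
    funext r
    by_cases hr : r < 27
    · exact hreg r hr
    · refine hf r fun h => ?_
      exact hr (lt_of_mem_writes_reductionProg h)
  cases s'
  simp only [initial] at hr hmem ⊢
  rw [hr, hmem]

end RAM

/-! ### The graph of the reduction and its edge list. -/

/-- The masks of the variables made true and made false by the vertex `u`. -/
def masks (K H H' u : ℕ) : ℕ × ℕ :=
  if u < K then (0, 0)
  else if u < K + H then (u - K, H * H' + H - 1 - (u - K))
  else (H * H' + (u - K - H) * H, (H' - 1) * H - (u - K - H) * H)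

/-- The three batches become one family of rows indexed by the vertex `u`, from which membership and
absence of repetitions can be read off. -/
theorem edgePairs_eq_flatMap (cs : List (List ℕ)) (H H' : ℕ) :
    edgePairs cs H H' = (List.range (cs.length + H + H')).flatMap fun u =>
      rowPairs cs u (min u cs.length) (masks cs.length H H' u).1 (masks cs.length H H' u).2 := by
  rw [List.range_add, List.range_add, List.flatMap_append, List.flatMap_append, List.flatMap_map,
    List.flatMap_map, edgePairs]
  congr 1
  · congr 1
    · refine List.flatMap_congr fun i hi => ?_
      have := List.mem_range.1 hi
      simp [masks, this, this.le]
    · refine List.flatMap_congr fun i hi => ?_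
      have := List.mem_range.1 hi
      simp [masks, this]
  · refine List.flatMap_congr fun i hi => ?_
    have := List.mem_range.1 hi
    simp [masks, show ¬ cs.length + H + i < cs.length by lia,
      show min (cs.length + H + i) cs.length = cs.length by lia,
      show cs.length + H + i - cs.length - H = i by lia]

theorem mem_edgePairs {cs : List (List ℕ)} {H H' u v : ℕ} :
    (u, v) ∈ edgePairs cs H H' ↔ u < cs.length + H + H' ∧ v < u ∧ v < cs.length ∧
      Falsified (masks cs.length H H' u).1 (masks cs.length H H' u).2 (cs.getD v []) := by
  simp only [edgePairs_eq_flatMap, rowPairs, List.mem_flatMap, List.mem_map, List.mem_filter,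
    List.mem_range, decide_eq_true_eq, Prod.mk.injEq, lt_min_iff]
  constructor
  · rintro ⟨u, hu, v, ⟨⟨hv, hv'⟩, hF⟩, rfl, rfl⟩
    exact ⟨hu, hv, hv', hF⟩
  · rintro ⟨hu, hv, hv', hF⟩
    exact ⟨u, hu, v, ⟨⟨hv, hv'⟩, hF⟩, rfl, rfl⟩

theorem nodup_edgePairs (cs : List (List ℕ)) (H H' : ℕ) : (edgePairs cs H H').Nodup := by
  rw [edgePairs_eq_flatMap, List.nodup_flatMap]
  refine ⟨fun u _ => ?_, List.nodup_range.imp fun {u u'} huu' => ?_⟩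
  · rw [rowPairs]
    exact (List.nodup_range.filter _).map fun a b h => congrArg Prod.snd h
  · intro e he he'
    simp only [rowPairs, List.mem_map] at he he'
    obtain ⟨v, -, rfl⟩ := he
    obtain ⟨v', -, h⟩ := he'
    exact huu' (congrArg Prod.fst h).symm

/-- The graph with the edges `edgePairs cs H H'`. -/
def reductionGraph (cs : List (List ℕ)) (H H' N : ℕ) : SimpleGraph (Fin N) :=
  SimpleGraph.fromRel fun u v => ((u : ℕ), (v : ℕ)) ∈ edgePairs cs H H'

/-- All pairs are written with the larger vertex first, so there are no loops and no edge is listed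
in both directions. -/
theorem exists_listsEdges_reductionGraph (cs : List (List ℕ)) {H H' N : ℕ}
    (hN : N = cs.length + H + H') :
    ∃ l : List (Fin N × Fin N), ListsEdges (reductionGraph cs H H' N) l ∧
      encodeGraph N l = N :: (edgePairs cs H H').length :: pairWords (edgePairs cs H H') := by
  have hlt : ∀ e ∈ edgePairs cs H H', e.2 < e.1 ∧ e.1 < N := by
    rintro ⟨u, v⟩ h
    rw [mem_edgePairs] at h
    exact ⟨h.2.1, by lia⟩
  obtain ⟨l, hl⟩ : ∃ l : List (Fin N × Fin N),
      l.map (fun e => ((e.1 : ℕ), (e.2 : ℕ))) = edgePairs cs H H' := by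
    generalize edgePairs cs H H' = E at hlt
    induction E with
    | nil => exact ⟨[], rfl⟩
    | cons e E ih =>
      obtain ⟨l, hl⟩ := ih fun e he => hlt e (by simp [he])
      have h := hlt e (by simp)
      exact ⟨(⟨e.1, h.2⟩, ⟨e.2, h.1.trans h.2⟩) :: l, by simp [hl]⟩
  have hmem : ∀ {u v : Fin N}, (u, v) ∈ l ↔ ((u : ℕ), (v : ℕ)) ∈ edgePairs cs H H' := by
    intro u v
    rw [← hl, List.mem_map]
    constructor
    · exact fun h => ⟨_, h, rfl⟩
    · rintro ⟨⟨u', v'⟩, h, h'⟩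
      simp only [Prod.mk.injEq, Fin.val_inj] at h'
      rwa [h'.1, h'.2] at h
  have hlt' : ∀ {u v : Fin N}, (u, v) ∈ l → v < u := fun h => (hlt _ (hmem.1 h)).1
  refine ⟨l, ⟨?_, ?_⟩, ?_⟩
  · have hnd : l.Nodup := List.Nodup.of_map _ (hl ▸ nodup_edgePairs cs H H')
    refine List.Nodup.map_on ?_ hnd
    rintro ⟨u, v⟩ h ⟨u', v'⟩ h' heq
    have h1 := hlt' h
    have h2 := hlt' h'
    rcases Sym2.eq_iff.1 heq with ⟨h3, h4⟩ | ⟨h3, h4⟩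
    · simp_all
    · simp only at h3 h4
      subst h3 h4
      exact absurd h1 h2.not_gt
  · intro e
    induction e with | _ u v
    rw [SimpleGraph.mem_edgeSet, reductionGraph, SimpleGraph.fromRel_adj, List.mem_map, ← hmem,
      ← hmem]
    constructor
    · rintro ⟨-, h | h⟩
      · exact ⟨_, h, rfl⟩
      · exact ⟨_, h, Sym2.eq_swap⟩
    · rintro ⟨⟨u', v'⟩, h, heq⟩
      have := hlt' h
      rcases Sym2.eq_iff.1 heq with ⟨rfl, rfl⟩ | ⟨rfl, rfl⟩
      · exact ⟨this.ne', .inl h⟩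
      · exact ⟨this.ne, .inr h⟩
  · rw [encodeGraph, ← hl]
    simp [pairWords, List.flatMap_map]

/-! ### Bits of the masks and satisfying assignments. -/

theorem litTrue_iff_testBit {P Q l : ℕ} :
    LitTrue P Q l ↔ (if l % 2 = 0 then Q else P).testBit (l / 2) = true := by
  simp [LitTrue, Nat.testBit_eq_decide_div_mod_eq]

/-- The code of a literal, as in `encodeCNF`. -/
def literalCode {n : ℕ} (l : Fin n × Bool) : ℕ := 2 * (l.1 : ℕ) + l.2.toNat

/-- The clauses of a formula, as lists of codes of literals. -/
def clauseCodes {n : ℕ} (f : Std.Sat.CNF (Fin n)) : List (List ℕ) :=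
  f.clauses.toList.map fun c => c.map literalCode

theorem encodeCNF_eq {n : ℕ} (f : Std.Sat.CNF (Fin n)) :
    encodeCNF f = n :: (clauseCodes f).length :: clauseWords (clauseCodes f) := by
  simp only [encodeCNF, clauseCodes, clauseWords, List.flatMap_map, List.length_map]
  rfl

/-- The assignment that consists of the low bits `x` and the high bits `y`. -/
def joinBits (n x y : ℕ) (i : Fin n) : Bool :=
  if (i : ℕ) < n / 2 then x.testBit i else y.testBit (i - n / 2)

theorem exists_joinBits_eq {n : ℕ} (a : Fin n → Bool) :
    ∃ x < 2 ^ (n / 2), ∃ y < 2 ^ (n - n / 2), joinBits n x y = a := by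
  refine ⟨Nat.ofBits fun i : Fin (n / 2) => a ⟨i, by lia⟩, Nat.ofBits_lt_two_pow _,
    Nat.ofBits fun i : Fin (n - n / 2) => a ⟨n / 2 + i, by lia⟩, Nat.ofBits_lt_two_pow _, ?_⟩
  funext i
  rw [joinBits]
  split_ifs with h
  · rw [Nat.testBit_ofBits_lt _ _ h]
  · rw [Nat.testBit_ofBits_lt _ _ (by lia)]
    congr 1
    ext
    simp
    lia

section Bits

variable {n x y : ℕ}

/-- The mask of the variables made false by the assignment `x` of the lower half; variable `n`
counts as false. -/
theorem testBit_low_neg (hx : x < 2 ^ (n / 2)) (i : ℕ) (hi : i ≤ n) :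
    (2 ^ n + 2 ^ (n / 2) - 1 - x).testBit i =
      (decide (i = n) || (decide (i < n / 2) && !x.testBit i)) := by
  -- The term `2 ^ (n / 2) - (x + 1)` is the complement of `x` within the low `n / 2` bits, and `2 ^
  -- n` marks the fresh variable as false.
  rw [show 2 ^ n + 2 ^ (n / 2) - 1 - x = 2 ^ n + (2 ^ (n / 2) - (x + 1)) by lia]
  rcases hi.lt_or_eq with h | rfl
  · rw [Nat.testBit_two_pow_add_gt h, Nat.testBit_two_pow_sub_succ hx]
    simp [h.ne]
  · rw [Nat.testBit_two_pow_add_eq, Nat.testBit_two_pow_sub_succ hx]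
    simp [show ¬ i < i / 2 by lia]

theorem testBit_high_pos (hy : y < 2 ^ (n - n / 2)) (i : ℕ) (hi : i ≤ n) :
    (2 ^ n + y * 2 ^ (n / 2)).testBit i =
      (decide (i = n) || (decide (n / 2 ≤ i) && y.testBit (i - n / 2))) := by
  rcases hi.lt_or_eq with h | rfl
  · rw [Nat.testBit_two_pow_add_gt h, Nat.testBit_mul_two_pow]
    simp [h.ne]
  · rw [Nat.testBit_two_pow_add_eq, Nat.testBit_mul_two_pow, Nat.testBit_lt_two_pow hy]
    simp

theorem testBit_high_neg (hy : y < 2 ^ (n - n / 2)) (i : ℕ) :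
    ((2 ^ (n - n / 2) - 1) * 2 ^ (n / 2) - y * 2 ^ (n / 2)).testBit i =
      (decide (n / 2 ≤ i ∧ i < n) && !y.testBit (i - n / 2)) := by
  rw [← Nat.sub_mul, Nat.sub_sub, add_comm 1 y, Nat.testBit_mul_two_pow,
    Nat.testBit_two_pow_sub_succ hy, ← Bool.and_assoc, ← Bool.decide_and]
  congr 1
  rw [decide_eq_decide]
  lia

end Bits

theorem two_pow_half_mul (n : ℕ) : 2 ^ (n / 2) * 2 ^ (n - n / 2) = 2 ^ n := by
  rw [← pow_add]
  congr 1
  lia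

theorem masks_low {K n x : ℕ} (hx : x < 2 ^ (n / 2)) :
    masks K (2 ^ (n / 2)) (2 ^ (n - n / 2)) (K + x) = (x, 2 ^ n + 2 ^ (n / 2) - 1 - x) := by
  simp [masks, hx, two_pow_half_mul]

theorem masks_high {K n y : ℕ} :
    masks K (2 ^ (n / 2)) (2 ^ (n - n / 2)) (K + 2 ^ (n / 2) + y) =
      (2 ^ n + y * 2 ^ (n / 2), (2 ^ (n - n / 2) - 1) * 2 ^ (n / 2) - y * 2 ^ (n / 2)) := by
  rw [masks, if_neg (by lia), if_neg (by lia), two_pow_half_mul,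
    show K + 2 ^ (n / 2) + y - K - 2 ^ (n / 2) = y by lia]

/-- Each genuine variable belongs to exactly one half, and the masks of the other half have bit 0
there; so a literal can only be made true by its own half. -/
theorem litTrue_low_or_high {n x y : ℕ} (hx : x < 2 ^ (n / 2)) (hy : y < 2 ^ (n - n / 2))
    (l : Fin n × Bool) :
    (LitTrue x (2 ^ n + 2 ^ (n / 2) - 1 - x) (literalCode l) ∨
      LitTrue (2 ^ n + y * 2 ^ (n / 2))
        ((2 ^ (n - n / 2) - 1) * 2 ^ (n / 2) - y * 2 ^ (n / 2)) (literalCode l)) ↔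
      joinBits n x y l.1 = l.2 := by
  obtain ⟨i, b⟩ := l
  have hi := i.2
  rw [litTrue_iff_testBit, litTrue_iff_testBit]
  cases b
  · have h1 : literalCode (i, false) % 2 = 0 := by simp [literalCode]
    have h2 : literalCode (i, false) / 2 = i := by simp [literalCode]
    rw [h1, h2, if_pos rfl, if_pos rfl, testBit_low_neg hx _ hi.le, testBit_high_neg hy]
    by_cases h : (i : ℕ) < n / 2
    · simp [joinBits, h, hi.ne]
    · simp [joinBits, h, hi.ne, not_lt.1 h]
  · have h1 : literalCode (i, true) % 2 = 1 := by simp [literalCode]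
    have h2 : literalCode (i, true) / 2 = i := by simp [literalCode]; lia
    rw [h1, h2, if_neg (by simp), if_neg (by simp), testBit_high_pos hy _ hi.le]
    by_cases h : (i : ℕ) < n / 2
    · simp [joinBits, h, hi.ne]
    · have : x.testBit i = false :=
        Nat.testBit_lt_two_pow (hx.trans_le (Nat.pow_le_pow_right (by lia) (not_lt.1 h)))
      simp [joinBits, h, hi.ne, not_lt.1 h, this]

theorem sat_joinBits_iff {n x y : ℕ} (hx : x < 2 ^ (n / 2)) (hy : y < 2 ^ (n - n / 2))
    (f : Std.Sat.CNF (Fin n)) :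
    Std.Sat.CNF.Sat (joinBits n x y) f ↔ ∀ c ∈ clauseCodes f,
      ¬ (Falsified x (2 ^ n + 2 ^ (n / 2) - 1 - x) c ∧ Falsified (2 ^ n + y * 2 ^ (n / 2))
        ((2 ^ (n - n / 2) - 1) * 2 ^ (n / 2) - y * 2 ^ (n / 2)) c) := by
  have h1 : Std.Sat.CNF.Sat (joinBits n x y) f ↔
      ∀ c ∈ f.clauses.toList, ∃ l ∈ c, joinBits n x y l.1 = l.2 := by
    simp [Std.Sat.CNF.Sat, Std.Sat.CNF.eval, Std.Sat.CNF.Clause.eval, -Array.all_eq_true, Array.all_eq_true_iff_forall_mem]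
  rw [h1, clauseCodes, List.forall_mem_map]
  refine forall₂_congr fun c _ => ?_
  simp only [← litTrue_low_or_high hx hy, Falsified, List.forall_mem_map]
  push Not
  constructor
  · rintro ⟨l, hl, h⟩ h'
    exact ⟨l, hl, h.resolve_left (h' l hl)⟩
  · intro h
    by_contra! h'
    obtain ⟨l, hl, h2⟩ := h fun l hl => (h' l hl).1
    exact (h' l hl).2 h2

/-! ### Splitness and diameter of the reduction graph. -/

theorem reductionGraph_adj_of_le {cs : List (List ℕ)} {H H' N : ℕ} (hN : N = cs.length + H + H')
    {u w : Fin N} (hu : cs.length ≤ u) : (reductionGraph cs H H' N).Adj u w ↔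
      (w : ℕ) < cs.length ∧ Falsified (masks cs.length H H' u).1 (masks cs.length H H' u).2
        (cs.getD w []) := by
  rw [reductionGraph, SimpleGraph.fromRel_adj, mem_edgePairs, mem_edgePairs]
  constructor
  · rintro ⟨-, h | h⟩
    · exact ⟨h.2.2.1, h.2.2.2⟩
    · lia
  · rintro ⟨h1, h2⟩
    have hlt : (w : ℕ) < u := by lia
    exact ⟨fun h => by simp [h] at hlt, .inl ⟨by lia, hlt, h1, h2⟩⟩

/-- Clause vertices carry the masks `(0, 0)`, which satisfy no literal and therefore falsify every
clause; the rule for assignment vertices thus also produces the clique. -/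
theorem isClique_reductionGraph (cs : List (List ℕ)) {H H' N : ℕ} :
    (reductionGraph cs H H' N).IsClique {u | (u : ℕ) < cs.length} := by
  have key : ∀ u v : Fin N, (u : ℕ) < cs.length → v < u →
      ((u : ℕ), (v : ℕ)) ∈ edgePairs cs H H' := by
    intro u v hu hv
    rw [mem_edgePairs]
    refine ⟨by lia, hv, by lia, ?_⟩
    intro l _
    simp [masks, hu, LitTrue]
  intro u hu v hv huv
  rw [reductionGraph, SimpleGraph.fromRel_adj]
  refine ⟨huv, ?_⟩
  rcases lt_or_gt_of_ne huv with h | h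
  · exact .inr (key v u hv h)
  · exact .inl (key u v hu h)

theorem isSplit_reductionGraph {cs : List (List ℕ)} {H H' N : ℕ} (hN : N = cs.length + H + H') :
    (reductionGraph cs H H' N).IsSplit := by
  refine ⟨_, isClique_reductionGraph cs, ?_⟩
  intro u hu v hv _ h
  simp only [Set.mem_compl_iff, Set.mem_ofPred_eq, not_lt] at hu hv
  rw [reductionGraph_adj_of_le hN hu] at h
  lia

theorem reductionGraph_connected_and_diam {n : ℕ} (f : Std.Sat.CNF (Fin n)) {cs : List (List ℕ)}
    {N : ℕ} (hcs : cs = [2 * n + 1] :: [2 * n] :: clauseCodes f)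
    (hN : N = cs.length + 2 ^ (n / 2) + 2 ^ (n - n / 2)) (s : Prop) [Decidable s]
    (hs : s ↔ ∃ a, Std.Sat.CNF.Sat a f) :
    (reductionGraph cs (2 ^ (n / 2)) (2 ^ (n - n / 2)) N).Connected ∧
      (reductionGraph cs (2 ^ (n / 2)) (2 ^ (n - n / 2)) N).diam - 2 = if s then 1 else 0 := by
  have hlen : cs.length = (clauseCodes f).length + 2 := by simp [hcs]
  have hpos : ∀ {m l}, LitTrue m l (2 * n + 1) ↔ m.testBit n = true := by
    intro m l
    rw [litTrue_iff_testBit, if_neg (by lia), show (2 * n + 1) / 2 = n by lia]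
  have hneg : ∀ {m l}, LitTrue m l (2 * n) ↔ l.testBit n = true := by
    intro m l
    rw [litTrue_iff_testBit, if_pos (by lia), show 2 * n / 2 = n by lia]
  have hlow : ∀ {x}, x < 2 ^ (n / 2) → ¬ LitTrue x (2 ^ n + 2 ^ (n / 2) - 1 - x) (2 * n + 1) ∧
      LitTrue x (2 ^ n + 2 ^ (n / 2) - 1 - x) (2 * n) := by
    intro x hx
    rw [hpos, hneg, testBit_low_neg hx _ le_rfl, Nat.testBit_lt_two_pow
      (hx.trans_le (Nat.pow_le_pow_right (by lia) (Nat.div_le_self _ _)))]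
    simp
  have hhigh : ∀ {y}, y < 2 ^ (n - n / 2) →
      LitTrue (2 ^ n + y * 2 ^ (n / 2))
        ((2 ^ (n - n / 2) - 1) * 2 ^ (n / 2) - y * 2 ^ (n / 2)) (2 * n + 1) ∧
      ¬ LitTrue (2 ^ n + y * 2 ^ (n / 2))
        ((2 ^ (n - n / 2) - 1) * 2 ^ (n / 2) - y * 2 ^ (n / 2)) (2 * n) := by
    intro y hy
    rw [hpos, hneg, testBit_high_pos hy _ le_rfl, testBit_high_neg hy]
    simp
  set G := reductionGraph cs (2 ^ (n / 2)) (2 ^ (n - n / 2)) N with hG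
  have hadjL : ∀ {x} (hx : x < 2 ^ (n / 2)) {u w : Fin N}, (u : ℕ) = cs.length + x →
      (G.Adj u w ↔ (w : ℕ) < cs.length ∧
        Falsified x (2 ^ n + 2 ^ (n / 2) - 1 - x) (cs.getD w [])) := by
    intro x hx u w hu
    rw [hG, reductionGraph_adj_of_le hN (by lia), hu, masks_low hx]
  have hadjH : ∀ {y} {u w : Fin N}, (u : ℕ) = cs.length + 2 ^ (n / 2) + y →
      (G.Adj u w ↔ (w : ℕ) < cs.length ∧ Falsified (2 ^ n + y * 2 ^ (n / 2))
        ((2 ^ (n - n / 2) - 1) * 2 ^ (n / 2) - y * 2 ^ (n / 2)) (cs.getD w [])) := by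
    intro y u w hu
    rw [hG, reductionGraph_adj_of_le hN (by lia), hu, masks_high]
  -- Vertices 0 and 1 are the unit clauses of the fresh variable: low assignments make it false and
  -- are joined to its positive clause 0, high ones make it true and are joined to 1.
  refine SimpleGraph.connected_and_diam_sub_two (V := Fin N) (K := {u | (u : ℕ) < cs.length})
    (A := {u | ∃ x < 2 ^ (n / 2), (u : ℕ) = cs.length + x})
    (B := {u | ∃ y < 2 ^ (n - n / 2), (u : ℕ) = cs.length + 2 ^ (n / 2) + y})
    (a := ⟨0, by lia⟩) (b := ⟨1, by lia⟩) (isClique_reductionGraph cs)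
    (by simp [hlen]) (by simp [hlen]) ?_ ?_ ?_ s ?_
  · rintro u ⟨x, hx, hu⟩
    rw [hadjL hx hu]
    refine ⟨by simp [hlen], ?_⟩
    simp [hcs, Falsified, (hlow hx).1]
  · rintro u ⟨y, hy, hu⟩
    rw [hadjH hu]
    refine ⟨by simp [hlen], ?_⟩
    simp [hcs, Falsified, (hhigh hy).2]
  · intro u
    have := u.2
    by_cases h1 : (u : ℕ) < cs.length
    · exact .inl h1
    · by_cases h2 : (u : ℕ) < cs.length + 2 ^ (n / 2)
      · exact .inr (.inl ⟨u - cs.length, by lia, by lia⟩)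
      · exact .inr (.inr ⟨u - cs.length - 2 ^ (n / 2), by lia, by lia⟩)
  · rw [hs]
    constructor
    · rintro ⟨a, ha⟩
      obtain ⟨x, hx, y, hy, rfl⟩ := exists_joinBits_eq a
      rw [sat_joinBits_iff hx hy] at ha
      refine ⟨⟨cs.length + x, by lia⟩, ⟨x, hx, rfl⟩,
        ⟨cs.length + 2 ^ (n / 2) + y, by lia⟩, ⟨y, hy, rfl⟩, ?_, ?_, ?_⟩
      · simp only [ne_eq, Fin.mk.injEq]
        lia
      · rw [hadjL hx rfl]
        simp only [not_and]
        lia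
      · rintro ⟨w, hw⟩ ⟨h1, h2⟩
        rw [hadjL hx rfl] at h1
        rw [G.adj_comm, hadjH rfl] at h2
        -- The unit clauses are no common neighbours: clause 0 is satisfied by every high assignment
        -- and clause 1 by every low one. Any other common neighbour is a clause violated by the
        -- joined assignment.
        rcases w with _ | _ | w
        · simp [hcs, Falsified, (hhigh hy).1] at h2
        · simp [hcs, Falsified, (hlow hx).2] at h1
        · have hw' : w < (clauseCodes f).length := by
            have := h1.1
            simp only [hlen] at this
            lia
          simp only [hcs, List.getD_cons_succ, List.getD_eq_getElem _ _ hw'] at h1 h2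
          exact ha _ (List.getElem_mem hw') ⟨h1.2, h2.2⟩
    · rintro ⟨u, ⟨x, hx, hu⟩, v, ⟨y, hy, hv⟩, -, -, hcom⟩
      refine ⟨joinBits n x y, (sat_joinBits_iff hx hy f).2 ?_⟩
      intro c hc hF
      obtain ⟨w, hw, rfl⟩ := List.getElem_of_mem hc
      refine hcom ⟨w + 2, by lia⟩ ?_
      rw [G.adj_comm _ v, hadjL hx hu, hadjH hv]
      simp only [hcs, List.getD_cons_succ, List.getD_eq_getElem _ _ hw]
      exact ⟨⟨by lia, hF.1⟩, ⟨by lia, hF.2⟩⟩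

/-! ### Size of a formula, and correctness of the composed program. -/

theorem IsKCNF.length_le {n k : ℕ} {f : Std.Sat.CNF (Fin n)} (hf : IsKCNF k f) :
    (clauseCodes f).length ≤ (2 * n + 1) ^ k := by
  obtain ⟨hnd, hc⟩ := hf
  rw [clauseCodes, List.length_map, ← List.toFinset_card_of_nodup hnd]
  -- A clause of length at most `k` is determined by its first `k` entries, with `none` past the
  -- end, which leaves `2 * n + 1` choices per position.
  have hcard : Fintype.card (Fin k → Option (Fin n × Bool)) = (2 * n + 1) ^ k := by
    simp [mul_comm]
  rw [← hcard]
  refine Finset.card_le_card_of_injOn (fun cl i => cl[(i : ℕ)]?) (fun _ _ => Finset.mem_univ _) ?_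
  intro c h c' h' heq
  simp only [List.coe_toFinset, Set.mem_ofPred_eq] at h h'
  refine List.ext_getElem? fun i => ?_
  by_cases hi : i < k
  · exact congrFun heq ⟨i, hi⟩
  · rw [List.getElem?_eq_none ((hc c h).2.trans (not_lt.1 hi)),
      List.getElem?_eq_none ((hc c' h').2.trans (not_lt.1 hi))]

theorem IsKCNF.length_le_of_mem_clauseCodes {n k : ℕ} {f : Std.Sat.CNF (Fin n)} (hf : IsKCNF k f) :
    ∀ c ∈ clauseCodes f, c.length ≤ k := by
  rw [clauseCodes, List.forall_mem_map]
  intro c hc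
  rw [List.length_map]
  exact (hf.2 c hc).2

theorem lt_of_mem_clauseCodes {n : ℕ} (f : Std.Sat.CNF (Fin n)) :
    ∀ c ∈ clauseCodes f, ∀ l ∈ c, l < 2 * n := by
  rw [clauseCodes, List.forall_mem_map]
  intro c _
  rw [List.forall_mem_map]
  intro l _
  have h1 := l.1.2
  have h2 := Bool.toNat_le l.2
  rw [literalCode]
  lia

theorem RAM.bdd_initial {B : ℕ} (hB : 0 < B) {w : List ℕ} (hw : ∀ x ∈ w, x < B) :
    (initial w).Bdd B := by
  refine ⟨fun _ => hB, fun a => ?_⟩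
  rcases lt_or_ge a w.length with h | h
  · simp only [initial, List.getD_eq_getElem _ _ h]
    exact hw _ (List.getElem_mem h)
  · simp only [initial, List.getD_eq_default _ _ h]
    exact hB

/-- Reduce a formula to a graph, compute the diameter by `p`, and subtract `2`. -/
def RAM.satProg (k : ℕ) (p : RAM.Prog) : RAM.Prog :=
  .seq (reductionProg k) (.seq p (.seq (.const 1 2) (.arith .sub 0 0 1)))

/-- The bound for the numbers that occur in the reduction. -/
def numberBound (k n M N : ℕ) : ℕ :=
  3 * (N * (M + 2)) + 2 * (M * (k + 1)) + 3 * 2 ^ n + 2 * n + k + 21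

open Classical in
theorem outputs_satProg {k : ℕ} (hk : 2 ≤ k) {p : RAM.Prog} {b C : ℝ} (hb : 0 < b)
    (hp : ∀ (n : ℕ) (G : SimpleGraph (Fin n)), G.Connected → G.IsKATFree k ∧ G.IsChordal →
      ∀ l : List (Fin n × Fin n), ListsEdges G l →
        RAM.Outputs p (encodeGraph n l) G.diam (C * ((G.edgeSet.ncard : ℝ) + 1) ^ b))
    {κ n M N : ℕ} {f : Std.Sat.CNF (Fin n)} (hf : IsKCNF κ f) (hκ : 1 ≤ κ)
    (hM : M = (clauseCodes f).length) (hN : N = M + 2 + 2 ^ (n / 2) + 2 ^ (n - n / 2)) :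
    RAM.Outputs (RAM.satProg κ p) (encodeCNF f) (if ∃ a, Std.Sat.CNF.Sat a f then 1 else 0)
      ((RAM.reductionSteps κ n M N * (2 * (numberBound κ n M N).size + 1) : ℕ) +
        |C| * ((N * (M + 2) : ℕ) + 1 : ℝ) ^ b + 8) := by
  have hlen := hf.length_le_of_mem_clauseCodes
  have hlit := lt_of_mem_clauseCodes f
  obtain ⟨cs', hcs'⟩ : ∃ cs', cs' = [2 * n + 1] :: [2 * n] :: clauseCodes f := ⟨_, rfl⟩
  have hcsl : cs'.length = M + 2 := by simp [hcs', hM]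
  have hN' : N = cs'.length + 2 ^ (n / 2) + 2 ^ (n - n / 2) := by rw [hcsl]; exact hN
  have hNM : M ≤ N * (M + 2) := by
    have : N ≤ N * (M + 2) := Nat.le_mul_of_pos_right _ (by lia)
    lia
  have hw : ∀ x ∈ encodeCNF f, x < numberBound κ n M N := by
    rw [encodeCNF_eq, ← hM]
    simp only [List.mem_cons, clauseWords, List.mem_flatMap, numberBound]
    rintro x (rfl | rfl | ⟨c, hc, rfl | hx⟩)
    · lia
    · lia
    · have := hlen c hc
      lia
    · have := hlit c hc x hx
      lia
  obtain ⟨t₁, ht₁, he₁⟩ := RAM.exec_reductionProg (B := numberBound κ n M N) (cs' := cs')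
    (N := N) (k := κ) (encodeCNF_eq f ▸ RAM.bdd_initial (by rw [numberBound]; lia) hw) hlen
    (fun c hc l hl => by have := hlit c hc l hl; lia) hcs' rfl rfl (by rw [← hM]; exact hN) hκ
    (by rw [← hM, two_pow_half_mul, numberBound]; lia)
  rw [← encodeCNF_eq, ← hM] at *
  obtain ⟨l, hl, henc⟩ := exists_listsEdges_reductionGraph cs' hN'
  obtain ⟨hconn, hdiam⟩ := reductionGraph_connected_and_diam f hcs' hN' _ Iff.rfl
  have hsplit := isSplit_reductionGraph hN'
  obtain ⟨s, t₂, he₂, hs, ht₂⟩ := hp N _ hconn ⟨hsplit.isKATFree hk, hsplit.isChordal⟩ l hl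
  rw [← henc] at he₁
  refine ⟨_, _, .seq he₁ (.seq he₂ (.seq (.const 1 2 s) (.arith .sub 0 0 1 _))), ?_, ?_⟩
  · simpa [hs] using hdiam
  · have hd : (SimpleGraph.diam (reductionGraph cs' (2 ^ (n / 2)) (2 ^ (n - n / 2)) N)).size ≤ 2 := by
      refine Nat.size_le.2 ?_
      split_ifs at hdiam <;> lia
    have hm : (reductionGraph cs' (2 ^ (n / 2)) (2 ^ (n - n / 2)) N).edgeSet.ncard ≤
        N * (M + 2) := by
      refine hl.ncard_edgeSet_le.trans ?_
      have h1 : l.length = (edgePairs cs' (2 ^ (n / 2)) (2 ^ (n - n / 2))).length := by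
        rw [encodeGraph] at henc
        exact (List.cons.inj (List.cons.inj henc).2).1
      have h2 := length_edgePairs_le cs' (2 ^ (n / 2)) (2 ^ (n - n / 2))
      rwa [← hN', hcsl, ← h1] at h2
    -- The constant `C` may be negative, hence the absolute value.
    have h2 : C * (((reductionGraph cs' (2 ^ (n / 2)) (2 ^ (n - n / 2)) N).edgeSet.ncard : ℝ) + 1) ^ b
        ≤ |C| * ((N * (M + 2) : ℕ) + 1 : ℝ) ^ b := by
      refine mul_le_mul (le_abs_self C) (Real.rpow_le_rpow (by positivity) ?_ hb.le) (by positivity)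
        (abs_nonneg C)
      exact add_le_add_left (by exact_mod_cast hm) 1
    have h3 : (1 + Nat.size 2) + (1 + (SimpleGraph.diam (reductionGraph cs' (2 ^ (n / 2))
        (2 ^ (n - n / 2)) N)).size + Nat.size 2) ≤ 8 := by
      have : Nat.size 2 = 2 := by decide
      lia
    have h1 : (t₁ : ℝ) ≤ (RAM.reductionSteps κ n M N * (2 * (numberBound κ n M N).size + 1) : ℕ) := by
      exact_mod_cast ht₁
    have h3' : (((1 + Nat.size 2) + (1 + (SimpleGraph.diam (reductionGraph cs' (2 ^ (n / 2))
        (2 ^ (n - n / 2)) N)).size + Nat.size 2) : ℕ) : ℝ) ≤ 8 := by exact_mod_cast h3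
    have h4 : (s.setReg 1 2).reg 0 = s.reg 0 := rfl
    have h5 : (s.setReg 1 2).reg 1 = 2 := rfl
    rw [h4, h5, hs]
    push_cast at h1 h2 h3' ⊢
    linarith

theorem IsKCNF.mono {n k k' : ℕ} {f : Std.Sat.CNF (Fin n)} (hf : IsKCNF k f) (h : k ≤ k') :
    IsKCNF k' f :=
  ⟨hf.1, fun c hc => ⟨(hf.2 c hc).1, (hf.2 c hc).2.trans h⟩⟩

/-! ### Running time of the reduction; `X` stands for `2 ^ (n - n / 2)`. -/

section Estimates

variable {k n M N X : ℕ}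

theorem vertices_le (hX : 1 ≤ X) (hN : N ≤ M + 2 + 2 * X) : N ≤ (M + 4) * X := by
  nlinarith

theorem edges_le (hX : 1 ≤ X) (hN : N ≤ M + 2 + 2 * X) :
    N * (M + 2) + 1 ≤ (M + 4) ^ 2 * X := by
  have h := Nat.mul_le_mul_right (M + 2) (vertices_le hX hN)
  nlinarith

theorem reductionSteps_le (hX : 1 ≤ X) (hN : N ≤ M + 2 + 2 * X) :
    RAM.reductionSteps k n M N ≤ 190 * ((M + 4) ^ 2 * X * ((k + 1) * (n + 1))) := by
  obtain ⟨Z, hZ⟩ : ∃ Z, Z = (k + 1) * (n + 1) := ⟨_, rfl⟩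
  have hk : k + 1 ≤ Z := hZ ▸ Nat.le_mul_of_pos_right _ (by lia)
  have hn : n + 1 ≤ Z := hZ ▸ Nat.le_mul_of_pos_left _ (by lia)
  have hrow : RAM.rowSteps k n (M + 2) + 7 ≤ 17 * ((M + 4) * Z) := by
    have h : RAM.pairSteps k n + 2 ≤ 17 * Z := by
      rw [RAM.pairSteps, hZ]
      nlinarith
    rw [RAM.rowSteps]
    nlinarith [Nat.mul_le_mul_left (M + 2) h]
  have h1 : N * (RAM.rowSteps k n (M + 2) + 7) ≤ 17 * ((M + 4) ^ 2 * X * Z) :=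
    (Nat.mul_le_mul (vertices_le hX hN) hrow).trans (le_of_eq (by ring))
  have h2 : M * (k + 1) ≤ (M + 4) ^ 2 * X * Z := by
    refine Nat.mul_le_mul ?_ hk
    nlinarith [Nat.le_mul_of_pos_right ((M + 4) ^ 2) hX]
  have h3 : n + 1 ≤ (M + 4) ^ 2 * X * Z := hn.trans (Nat.le_mul_of_pos_left _ (by positivity))
  -- 190 is `17 + 13 + 160`, where the last term comes from `2 * n + 160 ≤ 160 * (n + 1)`.
  rw [RAM.reductionSteps, ← hZ]
  lia

/-- For fixed `k` all numbers are `2 ^ O(n)`, so logarithmic cost adds only a factor linear in `n`.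
The crude bound `2 ^ (2 * n * k)` on the number of clauses suffices, since only its logarithm
counts. -/
theorem size_numberBound_le (hX : 1 ≤ X) (hXn : X ≤ 2 ^ n) (hN : N ≤ M + 2 + 2 * X)
    (hM : M ≤ (2 * n + 1) ^ k) :
    2 * (numberBound k n M N).size + 1 ≤ (10 * k + 30) * (n + 1) := by
  have hq : M + 4 ≤ 2 ^ (2 * n * k + 3) := by
    have h1 : 2 * n + 1 ≤ 2 ^ (2 * n) := Nat.lt_two_pow_self
    have h2 : (2 * n + 1) ^ k ≤ 2 ^ (2 * n * k) := by
      rw [pow_mul]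
      exact Nat.pow_le_pow_left h1 k
    have h3 : 1 ≤ 2 ^ (2 * n * k) := Nat.one_le_two_pow
    rw [pow_add]
    lia
  obtain ⟨Y, hY⟩ : ∃ Y, Y = (M + 4) ^ 2 * 2 ^ n * 2 ^ k := ⟨_, rfl⟩
  have hk : k + 1 ≤ 2 ^ k := Nat.lt_two_pow_self
  have hn : n + 1 ≤ 2 ^ n := Nat.lt_two_pow_self
  have hYk : 2 ^ k ≤ Y := hY ▸ Nat.le_mul_of_pos_left _ (by positivity)
  have hYn : 2 ^ n ≤ Y := by
    rw [hY, mul_right_comm]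
    exact Nat.le_mul_of_pos_left _ (by positivity)
  have h1 : N * (M + 2) + 1 ≤ Y := by
    refine (edges_le hX hN).trans ((Nat.mul_le_mul_left _ hXn).trans ?_)
    exact hY ▸ Nat.le_mul_of_pos_right _ (by positivity)
  have h2 : M * (k + 1) ≤ Y := by
    rw [hY]
    refine Nat.mul_le_mul ?_ hk
    nlinarith [Nat.le_mul_of_pos_right ((M + 4) ^ 2) (show 0 < 2 ^ n by positivity)]
  have hle : numberBound k n M N ≤ 2 ^ 5 * Y := by
    rw [numberBound]
    lia
  have hYle : Y ≤ 2 ^ ((2 * n * k + 3) * 2 + n + k) := by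
    rw [hY, pow_add, pow_add, pow_mul]
    gcongr
  have hlt : numberBound k n M N < 2 ^ (4 * n * k + n + k + 12) := by
    calc _ ≤ 2 ^ 5 * Y := hle
      _ ≤ 2 ^ 5 * 2 ^ ((2 * n * k + 3) * 2 + n + k) := Nat.mul_le_mul_left _ hYle
      _ = 2 ^ (4 * n * k + n + k + 11) := by rw [← pow_add]; congr 1; ring
      _ < _ := Nat.pow_lt_pow_right (by lia) (by lia)
  have := Nat.size_le.2 hlt
  nlinarith

end Estimates

/-- Polynomial factors are absorbed by any increase of the base. -/
theorem exists_forall_pow_mul_pow_le (d : ℕ) {σ ρ : ℝ} (hσ : 0 ≤ σ) (h : σ < ρ) :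
    ∃ C : ℝ, 0 ≤ C ∧ ∀ n : ℕ, ((n : ℝ) + 1) ^ d * σ ^ (n + 1) ≤ C * ρ ^ n := by
  have hρ : 0 < ρ := hσ.trans_lt h
  obtain ⟨C, hC, hb⟩ := Asymptotics.bound_of_isBigO_nat_atTop
    (isLittleO_pow_const_mul_const_pow_const_pow_of_norm_lt (R := ℝ) d
      (r₁ := σ) (r₂ := ρ) (by rwa [Real.norm_of_nonneg hσ])).isBigO
  refine ⟨C * ρ, by positivity, fun n => ?_⟩
  have := hb (x := n + 1) (by positivity)
  rw [Real.norm_of_nonneg (by positivity), Real.norm_of_nonneg (by positivity)] at this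
  push_cast at this
  rw [pow_succ ρ n] at this
  linarith

theorem two_pow_half_le (n : ℕ) : ((2 ^ (n - n / 2) : ℕ) : ℝ) ≤ (2 : ℝ) ^ (((n : ℝ) + 1) / 2) := by
  push_cast
  rw [← Real.rpow_natCast]
  refine Real.rpow_le_rpow_of_exponent_le (by norm_num) ?_
  rw [le_div_iff₀ (by norm_num)]
  have : (n - n / 2) * 2 ≤ n + 1 := by lia
  exact_mod_cast this

theorem exists_time_bound {b : ℝ} (hb : b < 2) (C : ℝ) (k : ℕ) {ρ : ℝ}
    (hρ : (2 : ℝ) ^ (max b 1 / 2) < ρ) :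
    ∃ C' : ℝ, ∀ n M N : ℕ, M ≤ (2 * n + 1) ^ k →
      N = M + 2 + 2 ^ (n / 2) + 2 ^ (n - n / 2) →
      ((RAM.reductionSteps k n M N * (2 * (numberBound k n M N).size + 1) : ℕ) : ℝ) +
        |C| * ((N * (M + 2) : ℕ) + 1 : ℝ) ^ b + 8 ≤ C' * ρ ^ n := by
  -- The reduction itself takes time linear in `X`, so for `b < 1` it dominates the diameter
  -- computation; the exponent `β` covers both.
  set β := max b 1 with hβ
  have hβ1 : 1 ≤ β := le_max_right _ _
  have hβ2 : β ≤ 2 := max_le hb.le (by norm_num)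
  set σ := (2 : ℝ) ^ (β / 2) with hσ
  have hσ1 : 1 ≤ σ := Real.one_le_rpow (by norm_num) (by linarith)
  -- With `a = n + 1`, the reduction contributes `a ^ (2 * k + 2)`, and the diameter computation `(a
  -- ^ (2 * k)) ^ β ≤ a ^ (4 * k)`; the degree `4 * k + 2` exceeds both.
  obtain ⟨C₀, hC₀, hbound⟩ := exists_forall_pow_mul_pow_le (4 * k + 2) (by linarith) hρ
  set c : ℝ := 2 ^ k + 4 with hc
  have hc1 : 1 ≤ c := by
    have : (0 : ℝ) < 2 ^ k := by positivity
    linarith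
  set c₁ : ℝ := 190 * (k + 1) * (10 * k + 30) with hc₁
  have hc₁0 : 0 ≤ c₁ := by positivity
  refine ⟨(c ^ 4 * (c₁ + |C|) + 8) * C₀, fun n M N hM hN => ?_⟩
  obtain ⟨X, hX⟩ : ∃ X, X = 2 ^ (n - n / 2) := ⟨_, rfl⟩
  have hX1 : 1 ≤ X := hX ▸ Nat.one_le_two_pow
  have hXn : X ≤ 2 ^ n := hX ▸ Nat.pow_le_pow_right (by lia) (Nat.sub_le _ _)
  have hN' : N ≤ M + 2 + 2 * X := by
    have : 2 ^ (n / 2) ≤ X := hX ▸ Nat.pow_le_pow_right (by lia) (by lia)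
    lia
  set a : ℝ := (n : ℝ) + 1 with ha
  have ha1 : 1 ≤ a := by
    have : (0 : ℝ) ≤ n := Nat.cast_nonneg n
    linarith
  have hak : 1 ≤ a ^ k := one_le_pow₀ ha1
  have hq : (((M + 4 : ℕ)) : ℝ) ≤ c * a ^ k := by
    have h1 : (M : ℝ) ≤ (2 * a) ^ k := by
      have : (M : ℝ) ≤ (2 * n + 1 : ℝ) ^ k := by exact_mod_cast hM
      refine this.trans (pow_le_pow_left₀ (by positivity) (by linarith) _)
    rw [mul_pow] at h1
    push_cast
    rw [hc, add_mul]
    linarith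
  have hXσ : ((X : ℕ) : ℝ) ^ β ≤ σ ^ (n + 1) := by
    calc ((X : ℕ) : ℝ) ^ β ≤ ((2 : ℝ) ^ (((n : ℝ) + 1) / 2)) ^ β :=
          Real.rpow_le_rpow (by positivity) (hX ▸ two_pow_half_le n) (by linarith)
      _ = σ ^ (n + 1) := by
          rw [hσ, ← Real.rpow_natCast, ← Real.rpow_mul (by norm_num), ← Real.rpow_mul (by norm_num)]
          congr 1
          push_cast
          ring
  have hXR : (1 : ℝ) ≤ X := by exact_mod_cast hX1
  have hXβ : (X : ℝ) ≤ σ ^ (n + 1) := (Real.self_le_rpow_of_one_le hXR hβ1).trans hXσ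
  set S := σ ^ (n + 1) with hS
  have hS1 : 1 ≤ S := one_le_pow₀ hσ1
  set A := a ^ (4 * k + 2) with hA
  have hA1 : 1 ≤ A := one_le_pow₀ ha1
  have hfirst : ((RAM.reductionSteps k n M N * (2 * (numberBound k n M N).size + 1) : ℕ) : ℝ) ≤
      c ^ 4 * c₁ * (A * S) := by
    have h := Nat.mul_le_mul (reductionSteps_le (k := k) (n := n) hX1 hN')
      (size_numberBound_le hX1 hXn hN' hM)
    calc _ ≤ ((190 * ((M + 4) ^ 2 * X * ((k + 1) * (n + 1))) * ((10 * k + 30) * (n + 1)) : ℕ) : ℝ) := by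
          exact_mod_cast h
      _ = c₁ * (((M + 4 : ℕ) : ℝ) ^ 2 * a ^ 2) * X := by
          rw [hc₁, ha]
          push_cast
          ring
      _ ≤ c₁ * ((c * a ^ k) ^ 2 * a ^ 2) * S := by gcongr
      _ = c₁ * (c ^ 2 * a ^ (2 * k + 2)) * S := by ring
      _ ≤ c₁ * (c ^ 4 * A) * S := by
          rw [hA]
          gcongr
          · lia
          · lia
      _ = _ := by ring
  have hsecond : |C| * ((N * (M + 2) : ℕ) + 1 : ℝ) ^ b ≤ c ^ 4 * |C| * (A * S) := by
    have h1 : (((N * (M + 2) : ℕ) : ℝ) + 1) ≤ ((M + 4 : ℕ) : ℝ) ^ 2 * X := by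
      exact_mod_cast edges_le hX1 hN'
    have h2 : (((N * (M + 2) : ℕ) : ℝ) + 1) ^ b ≤ (c ^ 4 * A) * S := by
      calc (((N * (M + 2) : ℕ) : ℝ) + 1) ^ b ≤ (((N * (M + 2) : ℕ) : ℝ) + 1) ^ β :=
            Real.rpow_le_rpow_of_exponent_le (by simp; positivity) (le_max_left _ _)
        _ ≤ (((c * a ^ k) ^ 2) * X) ^ β := by
            refine Real.rpow_le_rpow (by positivity) (h1.trans ?_) (by linarith)
            gcongr
        _ = ((c * a ^ k) ^ 2) ^ β * (X : ℝ) ^ β := Real.mul_rpow (by positivity) (by positivity)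
        _ ≤ (((c * a ^ k) ^ 2) ^ (2 : ℝ)) * S := by
            gcongr
            exact one_le_pow₀ (one_le_mul_of_one_le_of_one_le hc1 hak)
        _ = (c ^ 4 * a ^ (4 * k)) * S := by
            rw [Real.rpow_ofNat]
            ring
        _ ≤ _ := by
            rw [hA]
            gcongr
            lia
    calc _ ≤ |C| * ((c ^ 4 * A) * S) := mul_le_mul_of_nonneg_left h2 (abs_nonneg C)
      _ = _ := by ring
  have hAS : 1 ≤ A * S := one_le_mul_of_one_le_of_one_le hA1 hS1
  calc _ ≤ (c ^ 4 * (c₁ + |C|) + 8) * (A * S) := by nlinarith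
    _ ≤ (c ^ 4 * (c₁ + |C|) + 8) * (C₀ * ρ ^ n) :=
        mul_le_mul_of_nonneg_left (hbound n) (by positivity)
    _ = _ := by ring

/-! ### The contradiction with SETH, and the theorem. -/

theorem not_hasTrulySubquadraticDiameterAlgorithm {k : ℕ} (hk : 2 ≤ k) (hS : SETH) :
    ¬ HasTrulySubquadraticDiameterAlgorithm (fun _ G => G.IsKATFree k ∧ G.IsChordal) := by
  rintro ⟨p, b, C, hb0, hb2, hp⟩
  have hσ : (2 : ℝ) ^ (max b 1 / 2) < 2 := by
    have h : max b 1 < 2 := max_lt hb2 (by norm_num)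
    calc (2 : ℝ) ^ (max b 1 / 2) < 2 ^ (1 : ℝ) :=
          Real.rpow_lt_rpow_of_exponent_lt (by norm_num) (by linarith)
      _ = 2 := Real.rpow_one 2
  -- The gap between `2 ^ (max b 1 / 2)` and `ρ` absorbs polynomial factors; the gap between `ρ` and
  -- 2 is the `ε` of SETH.
  obtain ⟨ρ, hρ, hρ2⟩ := exists_between hσ
  obtain ⟨κ, hκ⟩ := hS (2 - ρ) (by linarith)
  obtain ⟨C', hC'⟩ := exists_time_bound hb2 C (κ + 1) hρ
  -- Passing to `κ + 1` ensures that unit clauses are allowed.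
  refine hκ ⟨RAM.satProg (κ + 1) p, C', fun n f hf => ?_⟩
  have hf' := hf.mono (Nat.le_succ κ)
  obtain ⟨s, t, he, hs, ht⟩ := outputs_satProg hk hb0 hp hf' (by lia) rfl rfl
  refine ⟨s, t, he, ?_, ht.trans ?_⟩
  · convert hs
  · rw [sub_sub_cancel]
    exact hC' n _ _ hf'.length_le rfl

theorem mainTheorem7 (k : ℕ) (hk : 2 ≤ k) :
    (∀ (V : Type*) (G : SimpleGraph V), G.IsSplit → G.IsKATFree k) ∧
      (SETH → ¬ HasTrulySubquadraticDiameterAlgorithm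
        (fun _ G => G.IsKATFree k ∧ G.IsChordal)) :=
  ⟨fun _ _ hG => hG.isKATFree hk, not_hasTrulySubquadraticDiameterAlgorithm hk⟩
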